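/- \textbf{Theorem (Asymptotic zero distribution of multiplicative Hermite polynomials).} For $n\in\mathbb N_0$ and $s\in\mathbb C$ let $$H_n^*(x;s)=\sum_{j=0}^n(-1)^{n-j}\binom nj e^{-\frac s2(j^2-nj)}x^j ,$$ and for a complex polynomial $P$ of degree $n\ge 1$ let $\frac1n\sum_{z:\,P(z)=0}\delta_z$ (zeros counted with multiplicity) be its zero distribution, a probability measure on $\mathbb C$. Fix $s\in\mathbb R$. As $n\to\infty$, the zero distribution of $H_n^*(\cdot\,;s/n)$ converges weakly, as probability measures on $\mathbb C$, to a probability measure $\mu^{(s)}$ which is uniquely characterized, among probability measures on $\mathbb C$, by the following properties. (a) If $s\ge 0$, $\mu^{(s)}$ is supported on a compact subset of $(0,\infty)$. (b) If $s\le 0$, $\mu^{(s)}$ is supported on the unit circle $\{|z|=1\}$. (c) $\mu^{(s)}$ is invariant under $z\mapsto 1/z$. (d) For every integer $k\ge1$, $$\int_{\mathbb C}z^k\,\mu^{(s)}(\mathrm dz)=\frac{e^{sk/2}}{k}[u^{k-1}]\bigl((1+u)^ke^{sku}\bigr)=\frac{e^{sk/2}}{k}\sum_{j=0}^{k-1}\binom{k}{j+1}\frac{(sk)^j}{j!}=\frac{e^{sk/2}}{k}L^{(1)}_{k-1}(-ks),$$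 where $[u^m]f(u)$ is the coefficient of $u^m$ in the Taylor series of $f$ at $0$ and $L_n^{(\alpha)}(x)=\sum_{j=0}^n\binom{n+\alpha}{n-j}\frac{(-x)^j}{j!}$ is the associated Laguerre polynomial. Moreover, $\mu^{(s)}$ is the free multiplicative normal law with parameter $s$, i.e. its $S$-transform is $S(z)=e^{-s(z+\frac12)}$: writing $\psi(t)=\sum_{k\ge1}t^k\int_{\mathbb C} z^k\,\mu^{(s)}(\mathrm dz)$, one has $\psi(t)\ne0$ and $S(\psi(t))=\frac{1+\psi(t)}{\psi(t)}\,t$ for all sufficiently small $t\neq0$. -/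

import Mathlib

open MeasureTheory Filter Topology

noncomputable section

namespace MultHermite

/-- The multiplicative Hermite polynomial
`H_n^*(x; s) = ∑_{j=0}^n (-1)^{n-j} (n choose j) e^{-(s/2)(j^2 - n j)} x^j`. -/
def multHermite (n : ℕ) (s : ℂ) : Polynomial ℂ :=
  ∑ j ∈ Finset.range (n + 1),
    Polynomial.monomial j
      ((-1 : ℂ) ^ (n - j) * (n.choose j : ℂ) *
        Complex.exp (-(s / 2) * ((j : ℂ) ^ 2 - (n : ℂ) * (j : ℂ))))

theorem coeff_multHermite (n : ℕ) (s : ℂ) (m : ℕ) :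
    (multHermite n s).coeff m =
      if m ≤ n then (-1 : ℂ) ^ (n - m) * (n.choose m : ℂ) *
        Complex.exp (-(s / 2) * ((m : ℂ) ^ 2 - (n : ℂ) * (m : ℂ))) else 0 := by
  simp [multHermite, Polynomial.coeff_monomial]

theorem natDegree_multHermite (n : ℕ) (s : ℂ) : (multHermite n s).natDegree = n := by
  refine Polynomial.natDegree_eq_of_le_of_coeff_ne_zero ?_ ?_
  · refine (Polynomial.natDegree_le_iff_coeff_eq_zero).2 fun m hm => ?_
    rw [coeff_multHermite, if_neg (by omega)]
  · rw [coeff_multHermite, if_pos le_rfl]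
    simp [Complex.exp_ne_zero]

/-- The zero distribution of a complex polynomial `P` of degree `n`, as a measure on `ℂ`:
`(1/n) ∑ δ_z` over the complex zeros of `P`, counted with multiplicity. -/
def zeroMeasure (P : Polynomial ℂ) : Measure ℂ :=
  (P.natDegree : ENNReal)⁻¹ • (P.roots.map fun z => Measure.dirac z).sum

theorem multisetSum_dirac_univ (m : Multiset ℂ) :
    (m.map fun z => Measure.dirac z).sum (Set.univ : Set ℂ) = (m.card : ENNReal) := by
  induction m using Multiset.induction_on with
  | empty => simp
  | cons a m ih =>
    rw [Multiset.map_cons, Multiset.sum_cons, Measure.add_apply, ih, Multiset.card_cons]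
    simp [add_comm]

theorem isProbabilityMeasure_zeroMeasure (P : Polynomial ℂ) (hP : P.natDegree ≠ 0) :
    IsProbabilityMeasure (zeroMeasure P) := by
  constructor
  rw [zeroMeasure, Measure.smul_apply, multisetSum_dirac_univ,
    IsAlgClosed.card_roots_eq_natDegree, smul_eq_mul]
  exact ENNReal.inv_mul_cancel (by exact_mod_cast hP) (ENNReal.natCast_ne_top _)

/-- The zero distribution of a non-constant complex polynomial, as a probability measure on `ℂ`. -/
def zeroDistribution (P : Polynomial ℂ) (hP : P.natDegree ≠ 0) : ProbabilityMeasure ℂ :=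
  ⟨zeroMeasure P, isProbabilityMeasure_zeroMeasure P hP⟩

/-- The zero distribution of `H_n^*(·; s/n)`, for `n ≥ 1`. -/
def hermiteZeroDistribution (s : ℝ) (n : ℕ) (hn : n ≠ 0) : ProbabilityMeasure ℂ :=
  zeroDistribution (multHermite n ((s : ℂ) / (n : ℂ))) (by rwa [natDegree_multHermite])

/-- `μ` is supported on a compact subset of `(0, ∞)`. -/
def SupportedOnCompactPositive (μ : Measure ℂ) : Prop :=
  ∃ K : Set ℝ, IsCompact K ∧ K ⊆ Set.Ioi 0 ∧ μ (((fun x : ℝ => (x : ℂ)) '' K)ᶜ) = 0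

/-- `μ` is supported on the unit circle `{|z| = 1}`. -/
def SupportedOnUnitCircle (μ : Measure ℂ) : Prop :=
  μ ((Metric.sphere (0 : ℂ) 1)ᶜ) = 0

/-- The (analytic) `k`-th moment of a measure on `ℂ`. -/
def moment (μ : Measure ℂ) (k : ℕ) : ℂ := ∫ z, z ^ k ∂μ

/-- The `ψ`-transform `ψ_μ(t) = ∑_{k ≥ 1} m_k t^k`; the series converges for small `t` whenever
`μ` is compactly supported. -/
def psiTransform (μ : Measure ℂ) (t : ℂ) : ℂ := ∑' k : ℕ, moment μ (k + 1) * t ^ (k + 1)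

/-- `S` is (the germ at `0` of) the `S`-transform of `μ`: it is analytic at `0` and
`S(ψ_μ(t)) = t (1 + ψ_μ(t)) / ψ_μ(t)` for all small `t ≠ 0`. -/
def HasSTransform (μ : Measure ℂ) (S : ℂ → ℂ) : Prop :=
  AnalyticAt ℂ S 0 ∧
    ∀ᶠ t in 𝓝[≠] (0 : ℂ), psiTransform μ t ≠ 0 ∧
      S (psiTransform μ t) = (1 + psiTransform μ t) / psiTransform μ t * t

/-- `μ` is the free multiplicative normal law with parameter `s` (positive for `s ≥ 0`, unitary
for `s ≤ 0`): the compactly supported law with `S`-transform `z ↦ e^{-s(z + 1/2)}`. -/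
structure IsFreeMultiplicativeNormal (s : ℝ) (μ : Measure ℂ) : Prop where
  positive : 0 ≤ s → SupportedOnCompactPositive μ
  unitary : s ≤ 0 → SupportedOnUnitCircle μ
  sTransform : HasSTransform μ fun z => Complex.exp (-(s : ℂ) * (z + 1 / 2))

/-- The formal power series `(1 + u)^k e^{s k u}`. -/
def momentSeries (s : ℝ) (k : ℕ) : PowerSeries ℝ :=
  (1 + PowerSeries.X) ^ k * PowerSeries.rescale (s * (k : ℝ)) (PowerSeries.exp ℝ)

/-- The associated Laguerre polynomial
`L_n^{(α)}(x) = ∑_{j=0}^n (n+α choose n-j) (-x)^j / j!`, with the generalized binomial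
coefficient. -/
def laguerre (n : ℕ) (α x : ℝ) : ℝ :=
  ∑ j ∈ Finset.range (n + 1),
    Ring.choose ((n : ℝ) + α) (n - j) * ((-x) ^ j / (j.factorial : ℝ))

/-- The four properties (support in the positive case, support in the unitary case, invariance
under `z ↦ 1/z`, and the three formulas for the moments) that characterize the limit law. -/
structure LimitLawProperties (s : ℝ) (μ : Measure ℂ) : Prop where
  positive : 0 ≤ s → SupportedOnCompactPositive μ
  unitary : s ≤ 0 → SupportedOnUnitCircle μ
  map_inv : μ.map (fun z : ℂ => z⁻¹) = μ
  moment_coeff : ∀ k : ℕ, 1 ≤ k →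
    moment μ k =
      ((Real.exp (s * k / 2) / k * PowerSeries.coeff (k - 1) (momentSeries s k) : ℝ) : ℂ)
  moment_sum : ∀ k : ℕ, 1 ≤ k →
    moment μ k =
      ((Real.exp (s * k / 2) / k *
        ∑ j ∈ Finset.range k, (k.choose (j + 1) : ℝ) * ((s * k) ^ j / (j.factorial : ℝ)) : ℝ) : ℂ)
  moment_laguerre : ∀ k : ℕ, 1 ≤ k →
    moment μ k = ((Real.exp (s * k / 2) / k * laguerre (k - 1) 1 (-(k * s)) : ℝ) : ℂ)

end MultHermite

end

noncomputable section

namespace MultHermite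

/-! ### Lagrange inversion and the formal ψ-transform of the limit law -/

section FormalSeries

open PowerSeries

variable {K : Type*} [Field K] [CharZero K]

/-! Let `Q_n(t) = ∏ (1 - z_i t)` over the zeros of `H_n^*(·; σ)`, let `q = e^{σ/2}`, and let `ψ_n =
-t Q_n' / (n Q_n)` be the generating series of the moments of the zero distribution. Pascal's rule
gives `Q_{n+1}(t) = Q_n(qt) - t e^{σn/2} Q_n(t/q)`, and `Q_{n+1}'` is a multiple of the same
`Q_n(t/q)`. With `g_n = e^{σn/2} Q_n(t/q) / Q_n(qt)` this becomes a closed system: `ψ_{n+1} = t g_n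
(1 + ψ_{n+1})` (`psiSeries_succ`) and `t g_n' = n (ψ_n(qt) - ψ_n(t/q)) g_n`
(`X_mul_derivative_ratioSeries`).

If `nσ → s`, the difference `n (ψ(qt) - ψ(t/q))` tends to `s t ψ'`, so the limits satisfy `g =
e^{s/2 + sψ}` and `ψ = t e^{s/2} (1 + ψ) e^{sψ}`. Coefficientwise convergence is
`tendsto_coeff_psiSeries_and_ratioSeries`. Lagrange inversion turns the limit equation into the
moment formula (`coeff_normalPsi`), and solving it for `t` gives the S-transform
(`hasSTransform_of_moment_eq`).

Moments control weak limits once all zeros lie in one compact subset of the line or the circle. For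
`σ ≤ 0` the recursion keeps the zeros on the unit circle (`norm_eq_one_of_mem_roots_multHermite`).
For `σ > 0` sign changes produce positive zeros whose consecutive ratios exceed `q²`
(`exists_separated_zeros`). A majorant bound for the moments (`abs_coeff_psiSeries_le`) bounds these
uniformly above, and the symmetry `z ↦ 1/z` of the zeros bounds them below. Compactness of the space
of probability measures on a compact set and Stone–Weierstrass then give existence and uniqueness of
the limit; its inversion symmetry is inherited from the zeros. -/

theorem coeff_X_mul_derivative (f : K⟦X⟧) (n : ℕ) :
    coeff n (X * d⁄dX K f) = n * coeff n f := by
  cases n with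
  | zero => simp
  | succ n => rw [coeff_succ_X_mul, coeff_derivative]; push_cast; ring

/-- A linear first-order equation determines each coefficient from the earlier ones, since `n + 1`
is invertible. This replaces composition of the exponential with a power series when formal and
analytic objects are compared. -/
theorem eq_of_derivative_eq_mul {A F G : K⟦X⟧} (hF : d⁄dX K F = A * F) (hG : d⁄dX K G = A * G)
    (h0 : coeff 0 F = coeff 0 G) : F = G := by
  ext n
  induction n using Nat.strong_induction_on with
  | _ n ih =>
    cases n with
    | zero => exact h0
    | succ n =>
      have h1 := congrArg (coeff n) hF
      have h2 := congrArg (coeff n) hG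
      rw [coeff_derivative, coeff_mul] at h1 h2
      have h3 : coeff (n + 1) F * ((n : K) + 1) = coeff (n + 1) G * ((n : K) + 1) := by
        rw [h1, h2]
        refine Finset.sum_congr rfl fun p hp => ?_
        rw [ih p.2 (by have := Finset.HasAntidiagonal.mem_antidiagonal.1 hp; omega)]
      exact mul_right_cancel₀ (by exact_mod_cast n.succ_ne_zero) h3

/-- **Lagrange inversion** for formal power series over a field of characteristic zero. -/
theorem natCast_mul_coeff_pow_of_eq_X_mul_subst {φ Ψ : K⟦X⟧} (hΨ : HasSubst Ψ)
    (h : Ψ = X * φ.subst Ψ) {n m : ℕ} (hmn : m ≤ n) :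
    (n : K) * coeff n (Ψ ^ m) = m * coeff (n - m) (φ ^ n) := by
  induction n using Nat.strong_induction_on generalizing m with
  | _ n ih =>
    rcases Nat.eq_zero_or_pos m with rfl | hm
    · rcases Nat.eq_zero_or_pos n with rfl | hn
      · simp
      · simp [coeff_one, hn.ne']
    obtain ⟨N, rfl⟩ := Nat.exists_eq_add_of_le hmn
    have hX : X ∣ Ψ := ⟨_, h⟩
    have hvan : ∀ d, N < d → coeff N (Ψ ^ d) = 0 := fun d hd =>
      X_pow_dvd_iff.1 (pow_dvd_pow_of_dvd hX d) N hd
    -- With `n = m + N`, the equation `Ψ^m = X^m φ^m(Ψ)` reduces the degree from `n` to `N < n`, so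
    -- the induction hypothesis applies to the powers `Ψ^d` at degree `N`.
    have hc : coeff (m + N) (Ψ ^ m) = coeff N ((φ ^ m).subst Ψ) := by
      conv_lhs => rw [h, mul_pow, ← subst_pow hΨ, add_comm, coeff_X_pow_mul]
    have hsum : coeff N ((φ ^ m).subst Ψ) =
        ∑ d ∈ Finset.range (N + 1), coeff d (φ ^ m) * coeff N (Ψ ^ d) := by
      rw [coeff_subst' hΨ]
      refine finsum_eq_finsetSum_of_support_subset _ fun d hd => ?_
      simp only [Finset.coe_range, Set.mem_Iio]
      by_contra hlt
      exact hd (by simp [hvan d (by omega)])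
    have hmN : m + N - m = N := by omega
    rw [hc, hmN]
    rcases Nat.eq_zero_or_pos N with rfl | hN
    · rw [hsum]; simp
    have hN0 : (N : K) ≠ 0 := by exact_mod_cast hN.ne'
    have key : (N : K) * coeff N ((φ ^ m).subst Ψ) =
        coeff N (X * d⁄dX K (φ ^ m) * φ ^ N) := by
      rw [hsum, Finset.mul_sum, coeff_mul, Finset.Nat.sum_antidiagonal_eq_sum_range_succ
        (fun i j => coeff i (X * d⁄dX K (φ ^ m)) * coeff j (φ ^ N))]
      refine Finset.sum_congr rfl fun d hd => ?_
      rw [coeff_X_mul_derivative, mul_left_comm,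
        ih N (by omega) (Nat.lt_succ_iff.1 (Finset.mem_range.1 hd))]
      ring
    -- Both sides are `m (m + N) X φ^(m+N-1) φ'`; comparing coefficients of degree `N` leaves a
    -- common factor `N`, which is why `N = 0` was treated apart.
    have hder : ((m + N : ℕ) : K⟦X⟧) * (X * d⁄dX K (φ ^ m) * φ ^ N) =
        (m : K⟦X⟧) * (X * d⁄dX K (φ ^ (m + N))) := by
      rw [derivative_pow, derivative_pow]
      obtain ⟨m, rfl⟩ := Nat.exists_eq_succ_of_ne_zero hm.ne'
      have : m.succ + N - 1 = m + N := by omega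
      rw [this, Nat.succ_sub_one, pow_add φ m N]
      ring
    have hder' := congrArg (coeff N) hder
    rw [← map_natCast (C (R := K)), ← map_natCast (C (R := K)), coeff_C_mul, coeff_C_mul, ← key,
      coeff_X_mul_derivative] at hder'
    refine mul_left_cancel₀ hN0 ?_
    linear_combination hder'

/-- The formal power series `e^{s/2} (1 + u) e^{s u}`. -/
def lagrangeKernel (s : ℝ) : ℝ⟦X⟧ :=
  C (Real.exp (s / 2)) * ((1 + X) * rescale s (PowerSeries.exp ℝ))

theorem constantCoeff_lagrangeKernel (s : ℝ) :
    constantCoeff (lagrangeKernel s) = Real.exp (s / 2) := by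
  have : constantCoeff (rescale s (PowerSeries.exp ℝ)) = 1 := by
    rw [← coeff_zero_eq_constantCoeff_apply, coeff_rescale]; simp
  simp [lagrangeKernel, this]

theorem lagrangeKernel_pow (s : ℝ) (k : ℕ) :
    lagrangeKernel s ^ k = C (Real.exp (s * k / 2)) * momentSeries s k := by
  rw [lagrangeKernel, mul_pow, mul_pow, momentSeries, ← map_pow, ← map_pow,
    exp_pow_eq_rescale_exp, rescale_rescale, ← Real.exp_nat_mul]
  congr 3
  · ring_nf
  · ring_nf

theorem isUnit_coeff_one_X_mul_inv (s : ℝ) :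
    IsUnit (coeff 1 (X * (lagrangeKernel s)⁻¹)) := by
  rw [show (1 : ℕ) = 0 + 1 from rfl, coeff_succ_X_mul, coeff_zero_eq_constantCoeff_apply,
    constantCoeff_inv, constantCoeff_lagrangeKernel]
  simp [Real.exp_ne_zero]

/-- The formal `ψ`-transform of the free multiplicative normal law, i.e. the solution of
`Ψ = t e^{s/2} (1 + Ψ) e^{s Ψ}`. -/
def normalPsi (s : ℝ) : ℝ⟦X⟧ :=
  (X * (lagrangeKernel s)⁻¹).substInvOfIsUnit (isUnit_coeff_one_X_mul_inv s)

theorem hasSubst_normalPsi (s : ℝ) : HasSubst (normalPsi s) := HasSubst.substInvOfIsUnit _ _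

theorem normalPsi_eq_X_mul_subst (s : ℝ) :
    normalPsi s = X * (lagrangeKernel s).subst (normalPsi s) := by
  have h := subst_substInvOfIsUnit_right (X * (lagrangeKernel s)⁻¹) (by simp)
    (isUnit_coeff_one_X_mul_inv s)
  change (X * (lagrangeKernel s)⁻¹).subst (normalPsi s) = X at h
  have hs := hasSubst_normalPsi s
  rw [subst_mul hs, subst_X hs] at h
  have h2 : (lagrangeKernel s)⁻¹.subst (normalPsi s) *
      (lagrangeKernel s).subst (normalPsi s) = 1 := by
    rw [← subst_mul hs, PowerSeries.inv_mul_cancel _ (by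
      rw [constantCoeff_lagrangeKernel]; exact (Real.exp_pos _).ne'), ← coe_substAlgHom hs, map_one]
  calc normalPsi s = normalPsi s * ((lagrangeKernel s)⁻¹.subst (normalPsi s) *
        (lagrangeKernel s).subst (normalPsi s)) := by rw [h2, mul_one]
    _ = _ := by rw [← mul_assoc, h]

/-- The formal power series `e^{s/2} e^{s Ψ}`. -/
def normalExp (s : ℝ) : ℝ⟦X⟧ :=
  (C (Real.exp (s / 2)) * rescale s (PowerSeries.exp ℝ)).subst (normalPsi s)

theorem coeff_zero_normalPsi (s : ℝ) : coeff 0 (normalPsi s) = 0 := by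
  simp [normalPsi]

theorem coeff_zero_normalExp (s : ℝ) : coeff 0 (normalExp s) = Real.exp (s / 2) := by
  rw [normalExp, coeff_subst' (hasSubst_normalPsi s), finsum_eq_single _ 0]
  · simp [coeff_rescale]
  · intro d hd
    have := coeff_zero_normalPsi s
    rw [coeff_zero_eq_constantCoeff_apply] at this
    simp [this, hd]

/-- Separating the factor `1 + Ψ` from the exponential gives the exact limit form of
`psiSeries_succ`, with `normalExp` in the role of `ratioSeries`. -/
theorem normalPsi_eq (s : ℝ) : normalPsi s = X * (normalExp s * (1 + normalPsi s)) := by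
  have hs := hasSubst_normalPsi s
  conv_lhs => rw [normalPsi_eq_X_mul_subst]
  have : lagrangeKernel s = (C (Real.exp (s / 2)) * rescale s (PowerSeries.exp ℝ)) * (1 + X) := by
    rw [lagrangeKernel]; ring
  rw [this, subst_mul hs, subst_add hs, subst_X hs, ← coe_substAlgHom hs, map_one, coe_substAlgHom,
    normalExp]

theorem derivative_rescale_exp (s : ℝ) :
    d⁄dX ℝ (rescale s (PowerSeries.exp ℝ)) = C s * rescale s (PowerSeries.exp ℝ) := by
  ext n
  rw [coeff_derivative, coeff_C_mul, coeff_rescale, coeff_rescale, coeff_exp, coeff_exp,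
    Nat.factorial_succ]
  have h1 : ((n : ℝ) + 1) ≠ 0 := by positivity
  have h2 : (n.factorial : ℝ) ≠ 0 := by positivity
  simp only [eq_ratCast]
  push_cast
  field_simp
  ring

theorem derivative_normalExp (s : ℝ) :
    d⁄dX ℝ (normalExp s) = C s * d⁄dX ℝ (normalPsi s) * normalExp s := by
  have hs := hasSubst_normalPsi s
  have : d⁄dX ℝ (C (Real.exp (s / 2)) * rescale s (PowerSeries.exp ℝ)) =
      s • (C (Real.exp (s / 2)) * rescale s (PowerSeries.exp ℝ)) := by
    rw [Derivation.leibniz, derivative_C, derivative_rescale_exp, smul_zero, add_zero,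
      smul_eq_mul, smul_eq_C_mul]
    ring
  rw [normalExp, derivative_subst hs, this, subst_smul hs, smul_eq_C_mul]
  ring

/-- The moment formula of the free multiplicative normal law. -/
theorem coeff_normalPsi (s : ℝ) {k : ℕ} (hk : 1 ≤ k) :
    coeff k (normalPsi s) =
      Real.exp (s * k / 2) / k * coeff (k - 1) (momentSeries s k) := by
  have h := natCast_mul_coeff_pow_of_eq_X_mul_subst (hasSubst_normalPsi s)
    (normalPsi_eq_X_mul_subst s) hk
  rw [lagrangeKernel_pow, coeff_C_mul, pow_one, Nat.cast_one, one_mul] at h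
  have hk0 : (k : ℝ) ≠ 0 := by positivity
  field_simp
  linear_combination h

theorem coeff_momentSeries (s : ℝ) {k : ℕ} (hk : 1 ≤ k) :
    coeff (k - 1) (momentSeries s k) =
      ∑ j ∈ Finset.range k, (k.choose (j + 1) : ℝ) * ((s * k) ^ j / (j.factorial : ℝ)) := by
  obtain ⟨k, rfl⟩ := Nat.exists_eq_add_of_le' hk
  rw [momentSeries, mul_comm, coeff_mul, Nat.add_sub_cancel,
    Finset.Nat.sum_antidiagonal_eq_sum_range_succ_mk]
  refine Finset.sum_congr rfl fun j hj => ?_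
  have hj' : j ≤ k := Nat.lt_succ_iff.1 (Finset.mem_range.1 hj)
  have h1 : coeff (k - j) ((1 + X : ℝ⟦X⟧) ^ (k + 1)) = ((k + 1).choose (j + 1) : ℝ) := by
    have : (1 + X : ℝ⟦X⟧) ^ (k + 1) = ((1 + Polynomial.X : Polynomial ℝ) ^ (k + 1) :) := by simp
    rw [this, Polynomial.coeff_coe, Polynomial.coeff_one_add_X_pow]
    congr 1
    rw [← Nat.choose_symm (by omega : j + 1 ≤ k + 1)]
    congr 1; omega
  simp only
  rw [h1, coeff_rescale, coeff_exp]
  simp only [eq_ratCast]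
  push_cast
  ring

theorem sum_choose_eq_laguerre (s : ℝ) {k : ℕ} (hk : 1 ≤ k) :
    ∑ j ∈ Finset.range k, (k.choose (j + 1) : ℝ) * ((s * k) ^ j / (j.factorial : ℝ)) =
      laguerre (k - 1) 1 (-(k * s)) := by
  obtain ⟨k, rfl⟩ := Nat.exists_eq_add_of_le' hk
  rw [laguerre, Nat.add_sub_cancel]
  refine Finset.sum_congr rfl fun j hj => ?_
  have hj' : j ≤ k := Nat.lt_succ_iff.1 (Finset.mem_range.1 hj)
  have : ((k : ℝ) + 1) = ((k + 1 : ℕ) : ℝ) := by push_cast; ring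
  rw [this, Ring.choose_natCast, neg_neg, mul_comm s, ← Nat.choose_symm (by omega : j + 1 ≤ k + 1)]
  congr 3
  omega

end FormalSeries

/-! ### Recursion for the power sums of the zeros and its limit -/

section Recursion

open PowerSeries

/-- Together with `natCast_mul_coeff_normalExp` this determines both series: degree `k + 1` of `Ψ`
needs degrees up to `k` of both, and degree `k > 0` of the exponential needs `Ψ` up to `k` but
itself only below `k`, as the term with `p.1 = 0` vanishes. -/
theorem coeff_succ_normalPsi (s : ℝ) (k : ℕ) :
    coeff (k + 1) (normalPsi s) = coeff k (normalExp s) +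
      ∑ p ∈ Finset.HasAntidiagonal.antidiagonal k,
        coeff p.1 (normalExp s) * coeff p.2 (normalPsi s) := by
  conv_lhs => rw [normalPsi_eq]
  rw [coeff_succ_X_mul, mul_add, mul_one, map_add, coeff_mul]

theorem natCast_mul_coeff_normalExp (s : ℝ) (k : ℕ) :
    (k : ℝ) * coeff k (normalExp s) =
      ∑ p ∈ Finset.HasAntidiagonal.antidiagonal k,
        s * (p.1 * coeff p.1 (normalPsi s)) * coeff p.2 (normalExp s) := by
  rw [← coeff_X_mul_derivative, derivative_normalExp,
    show X * (C s * d⁄dX ℝ (normalPsi s) * normalExp s) =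
      (C s * (X * d⁄dX ℝ (normalPsi s))) * normalExp s by ring, coeff_mul]
  simp only [coeff_C_mul, coeff_X_mul_derivative]

/-- The reversed polynomial `∏ (1 - z_i t)` over the zeros `z_i` of `H_n^*(·; σ)`, as a formal
power series. -/
def hermiteSeries (n : ℕ) (σ : ℝ) : ℝ⟦X⟧ :=
  mk fun j => (-1) ^ j * (n.choose j : ℝ) * Real.exp (-(σ / 2) * ((j : ℝ) ^ 2 - n * j))

theorem constantCoeff_hermiteSeries (n : ℕ) (σ : ℝ) : constantCoeff (hermiteSeries n σ) = 1 := by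
  rw [← coeff_zero_eq_constantCoeff_apply, hermiteSeries, coeff_mk]; simp

theorem constantCoeff_rescale {R : Type*} [CommSemiring R] (a : R) (f : R⟦X⟧) :
    constantCoeff (rescale a f) = constantCoeff f := by
  rw [← coeff_zero_eq_constantCoeff_apply, coeff_rescale]; simp

theorem X_mul_derivative_rescale (a : ℝ) (f : ℝ⟦X⟧) :
    X * d⁄dX ℝ (rescale a f) = rescale a (X * d⁄dX ℝ f) := by
  ext n
  rw [coeff_X_mul_derivative, coeff_rescale, coeff_rescale, coeff_X_mul_derivative]
  ring

/-- Pascal's rule splits the coefficient in two. In each half the quadratic exponent changes by an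
affine function of `j`, that is, by a rescaling of the variable and a constant. -/
theorem hermiteSeries_succ (n : ℕ) (σ : ℝ) :
    hermiteSeries (n + 1) σ = rescale (Real.exp (σ / 2)) (hermiteSeries n σ) -
      X * (C (Real.exp (σ * n / 2)) * rescale (Real.exp (-(σ / 2))) (hermiteSeries n σ)) := by
  ext j
  cases j with
  | zero =>
    rw [map_sub, coeff_zero_X_mul, sub_zero, coeff_zero_eq_constantCoeff_apply,
      coeff_zero_eq_constantCoeff_apply, constantCoeff_rescale, constantCoeff_hermiteSeries,
      constantCoeff_hermiteSeries]
  | succ j =>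
    rw [map_sub, coeff_succ_X_mul, coeff_C_mul, coeff_rescale, coeff_rescale]
    simp only [hermiteSeries, coeff_mk, ← Real.exp_nat_mul]
    have h1 : Real.exp (-(σ / 2) * (((j + 1 : ℕ) : ℝ) ^ 2 - ((n + 1 : ℕ) : ℝ) * (j + 1 : ℕ))) =
        Real.exp ((j + 1 : ℕ) * (σ / 2)) *
          Real.exp (-(σ / 2) * (((j + 1 : ℕ) : ℝ) ^ 2 - n * (j + 1 : ℕ))) := by
      rw [← Real.exp_add]; congr 1; push_cast; ring
    have h2 : Real.exp (-(σ / 2) * (((j + 1 : ℕ) : ℝ) ^ 2 - ((n + 1 : ℕ) : ℝ) * (j + 1 : ℕ))) =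
        Real.exp (σ * n / 2) * (Real.exp (j * (-(σ / 2))) *
          Real.exp (-(σ / 2) * ((j : ℝ) ^ 2 - n * j))) := by
      rw [← Real.exp_add, ← Real.exp_add]; congr 1; push_cast; ring
    rw [Nat.choose_succ_succ' n j, Nat.cast_add, mul_add, add_mul]
    nth_rw 1 [h2]
    rw [h1]
    ring

/-- Absorption, `(j+1) C(n+1, j+1) = (n+1) C(n, j)`. The derivative reproduces the second term of
`hermiteSeries_succ`, and this coincidence closes the system for `psiSeries` and `ratioSeries`. -/
theorem derivative_hermiteSeries_succ (n : ℕ) (σ : ℝ) :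
    d⁄dX ℝ (hermiteSeries (n + 1) σ) = -((n + 1 : ℕ) : ℝ⟦X⟧) *
      (C (Real.exp (σ * n / 2)) * rescale (Real.exp (-(σ / 2))) (hermiteSeries n σ)) := by
  ext j
  rw [coeff_derivative, neg_mul, map_neg, ← map_natCast (C (R := ℝ)), coeff_C_mul, coeff_C_mul,
    coeff_rescale]
  simp only [hermiteSeries, coeff_mk, ← Real.exp_nat_mul]
  have h2 : Real.exp (-(σ / 2) * (((j + 1 : ℕ) : ℝ) ^ 2 - ((n + 1 : ℕ) : ℝ) * (j + 1 : ℕ))) =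
      Real.exp (σ * n / 2) * (Real.exp (j * (-(σ / 2))) *
        Real.exp (-(σ / 2) * ((j : ℝ) ^ 2 - n * j))) := by
    rw [← Real.exp_add, ← Real.exp_add]; congr 1; push_cast; ring
  have h3 : (((n + 1 : ℕ) : ℝ)) * n.choose j = ((n + 1).choose (j + 1) : ℝ) * ((j : ℝ) + 1) := by
    have := Nat.add_one_mul_choose_eq n j
    exact_mod_cast this
  rw [h2, pow_succ]
  linear_combination (-(-1) ^ j * Real.exp (σ * n / 2) * (Real.exp (j * (-(σ / 2))) *
        Real.exp (-(σ / 2) * ((j : ℝ) ^ 2 - n * j)))) * (-h3)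

/-- The formal `ψ`-transform of the zero distribution of `H_n^*(·; σ)`, for `n ≥ 1`. -/
def psiSeries (n : ℕ) (σ : ℝ) : ℝ⟦X⟧ :=
  X * (C (Real.exp (σ * (n - 1 : ℕ) / 2)) *
    rescale (Real.exp (-(σ / 2))) (hermiteSeries (n - 1) σ)) * (hermiteSeries n σ)⁻¹

/-- The quotient of rescaled Hermite polynomials that drives the recursion for `psiSeries`. -/
def ratioSeries (n : ℕ) (σ : ℝ) : ℝ⟦X⟧ :=
  C (Real.exp (σ * n / 2)) * rescale (Real.exp (-(σ / 2))) (hermiteSeries n σ) *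
    (rescale (Real.exp (σ / 2)) (hermiteSeries n σ))⁻¹

theorem hermiteSeries_ne_zero (n : ℕ) (σ : ℝ) : hermiteSeries n σ ≠ 0 := fun h => by
  have := constantCoeff_hermiteSeries n σ
  simp [h] at this

theorem psiSeries_mul (n : ℕ) (σ : ℝ) :
    psiSeries n σ * hermiteSeries n σ = X * (C (Real.exp (σ * (n - 1 : ℕ) / 2)) *
      rescale (Real.exp (-(σ / 2))) (hermiteSeries (n - 1) σ)) := by
  rw [psiSeries, mul_assoc, PowerSeries.inv_mul_cancel _ (by
    rw [constantCoeff_hermiteSeries]; exact one_ne_zero), mul_one]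

theorem ratioSeries_mul (n : ℕ) (σ : ℝ) :
    ratioSeries n σ * rescale (Real.exp (σ / 2)) (hermiteSeries n σ) =
      C (Real.exp (σ * n / 2)) * rescale (Real.exp (-(σ / 2))) (hermiteSeries n σ) := by
  rw [ratioSeries, mul_assoc, PowerSeries.inv_mul_cancel _ (by
    rw [constantCoeff_rescale, constantCoeff_hermiteSeries]; exact one_ne_zero), mul_one]

theorem X_mul_derivative_hermiteSeries (n : ℕ) (σ : ℝ) :
    X * d⁄dX ℝ (hermiteSeries n σ) = -((n : ℝ⟦X⟧) * psiSeries n σ * hermiteSeries n σ) := by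
  cases n with
  | zero =>
    have : hermiteSeries 0 σ = 1 := by
      ext j
      cases j <;> simp [hermiteSeries, coeff_one]
    rw [this, Derivation.map_one_eq_zero]; simp
  | succ n =>
    rw [mul_assoc, psiSeries_mul, derivative_hermiteSeries_succ, Nat.add_sub_cancel]
    ring

/-- Write `A`, `B` for the two rescaled polynomials in `Q = A - X B`, the constant being included in
`B`. Then `B = g A` and `ψ Q = X B`, so `ψ Q = X g A = X g (Q + X B) = X g (1 + ψ) Q`. -/
theorem psiSeries_succ (n : ℕ) (σ : ℝ) :
    psiSeries (n + 1) σ = X * (ratioSeries n σ * (1 + psiSeries (n + 1) σ)) := by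
  refine mul_right_cancel₀ (hermiteSeries_ne_zero (n + 1) σ) ?_
  have h1 := psiSeries_mul (n + 1) σ
  rw [Nat.add_sub_cancel, ← ratioSeries_mul] at h1
  have h2 := hermiteSeries_succ n σ
  rw [← ratioSeries_mul] at h2
  linear_combination (1 - X * ratioSeries n σ) * h1 - X * ratioSeries n σ * h2

/-- Logarithmic differentiation: numerator and denominator are rescalings of one series whose
logarithmic derivative is `-nψ`. -/
theorem X_mul_derivative_ratioSeries (n : ℕ) (σ : ℝ) :
    X * d⁄dX ℝ (ratioSeries n σ) = (n : ℝ⟦X⟧) * (rescale (Real.exp (σ / 2)) (psiSeries n σ) -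
      rescale (Real.exp (-(σ / 2))) (psiSeries n σ)) * ratioSeries n σ := by
  have hne : rescale (Real.exp (σ / 2)) (hermiteSeries n σ) ≠ 0 := fun h => by
    have := constantCoeff_rescale (Real.exp (σ / 2)) (hermiteSeries n σ)
    rw [h, constantCoeff_hermiteSeries] at this
    simp at this
  refine mul_right_cancel₀ hne ?_
  have h0 := ratioSeries_mul n σ
  have h1 := congrArg (fun f => X * d⁄dX ℝ f) h0
  have key : ∀ a : ℝ, X * d⁄dX ℝ (rescale a (hermiteSeries n σ)) =
      -((n : ℝ⟦X⟧) * rescale a (psiSeries n σ) * rescale a (hermiteSeries n σ)) := fun a => by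
    rw [X_mul_derivative_rescale, X_mul_derivative_hermiteSeries]
    simp
  simp only [Derivation.leibniz, derivative_C, smul_eq_mul, mul_zero, add_zero] at h1
  have k1 := key (Real.exp (σ / 2))
  have k2 := key (Real.exp (-(σ / 2)))
  linear_combination h1 - ratioSeries n σ * k1 + C (Real.exp (σ * n / 2)) * k2 +
    n * rescale (Real.exp (-(σ / 2))) (psiSeries n σ) * h0

theorem coeff_zero_psiSeries (n : ℕ) (σ : ℝ) : coeff 0 (psiSeries n σ) = 0 := by
  simp [psiSeries]

theorem coeff_zero_ratioSeries (n : ℕ) (σ : ℝ) :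
    coeff 0 (ratioSeries n σ) = Real.exp (σ * n / 2) := by
  simp [ratioSeries, constantCoeff_rescale, constantCoeff_hermiteSeries]

theorem coeff_succ_psiSeries (n : ℕ) (σ : ℝ) (k : ℕ) :
    coeff (k + 1) (psiSeries (n + 1) σ) = coeff k (ratioSeries n σ) +
      ∑ p ∈ Finset.HasAntidiagonal.antidiagonal k,
        coeff p.1 (ratioSeries n σ) * coeff p.2 (psiSeries (n + 1) σ) := by
  conv_lhs => rw [psiSeries_succ]
  rw [coeff_succ_X_mul, mul_add, mul_one, map_add, coeff_mul]

theorem natCast_mul_coeff_ratioSeries (n : ℕ) (σ : ℝ) (k : ℕ) :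
    (k : ℝ) * coeff k (ratioSeries n σ) =
      ∑ p ∈ Finset.HasAntidiagonal.antidiagonal k,
        n * (Real.exp (p.1 * (σ / 2)) - Real.exp (p.1 * (-(σ / 2)))) * coeff p.1 (psiSeries n σ) *
          coeff p.2 (ratioSeries n σ) := by
  rw [← coeff_X_mul_derivative, X_mul_derivative_ratioSeries, coeff_mul]
  refine Finset.sum_congr rfl fun p _ => ?_
  rw [← map_natCast (C (R := ℝ)), coeff_C_mul, map_sub, coeff_rescale, coeff_rescale,
    Real.exp_nat_mul, Real.exp_nat_mul]
  ring

theorem tendsto_natCast_mul_exp_sub_exp {s : ℝ} {σ : ℕ → ℝ}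
    (hσ : Tendsto (fun n : ℕ => n * σ n) atTop (𝓝 s)) (a : ℝ) :
    Tendsto (fun n : ℕ => n * (Real.exp (a * (σ n / 2)) - Real.exp (a * (-(σ n / 2))))) atTop
      (𝓝 (s * a)) := by
  have h0 : Tendsto σ atTop (𝓝 0) := by
    have h := hσ.mul (tendsto_inv_atTop_nhds_zero_nat (𝕜 := ℝ))
    rw [mul_zero] at h
    refine h.congr' ?_
    filter_upwards [eventually_ne_atTop 0] with n hn
    have : (n : ℝ) ≠ 0 := by exact_mod_cast hn
    field_simp
  set f : ℝ → ℝ := fun x => Real.exp (a * (x / 2)) - Real.exp (a * (-(x / 2))) with hf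
  have hd : HasDerivAt f a 0 := by
    have h1 : HasDerivAt (fun x : ℝ => a * (x / 2)) (a * (1 / 2)) 0 :=
      ((hasDerivAt_id (0 : ℝ)).div_const 2).const_mul a
    have h2 : HasDerivAt (fun x : ℝ => a * (-(x / 2))) (a * (-(1 / 2))) 0 :=
      (((hasDerivAt_id (0 : ℝ)).div_const 2).neg).const_mul a
    have h3 := h1.exp.sub h2.exp
    convert! h3 using 1
    simp; ring
  -- The slope with its value at `0` filled in, so that indices with `σ n = 0` need no separate
  -- treatment.
  have hc : Tendsto (dslope f 0) (𝓝 0) (𝓝 a) := by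
    have := (continuousAt_dslope_same.2 hd.differentiableAt).tendsto
    rwa [dslope_same, hd.deriv] at this
  have := hσ.mul (hc.comp h0)
  refine this.congr fun n => ?_
  have hs := sub_smul_dslope f 0 (σ n)
  have hf0 : f 0 = 0 := by simp [hf]
  rw [hf0, sub_zero, sub_zero, smul_eq_mul] at hs
  simp only [Function.comp_apply]
  rw [mul_assoc, hs]

/-- Passage to the limit in the two coefficient recursions, by induction on the degree. The sequence
`σ` is quantified inside the induction because `ratioSeries n (σ n)` involves `psiSeries n (σ n)`,
whose index and parameter are offset by one; it is reached by applying the hypothesis to `n ↦ σ (n +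
1)`. -/
theorem tendsto_coeff_psiSeries_and_ratioSeries (s : ℝ) (k : ℕ) :
    ∀ σ : ℕ → ℝ, Tendsto (fun n : ℕ => n * σ n) atTop (𝓝 s) →
      Tendsto (fun n => coeff k (psiSeries (n + 1) (σ n))) atTop (𝓝 (coeff k (normalPsi s))) ∧
      Tendsto (fun n => coeff k (ratioSeries n (σ n))) atTop (𝓝 (coeff k (normalExp s))) := by
  induction k using Nat.strong_induction_on with
  | _ k ih =>
  have hψ : ∀ σ : ℕ → ℝ, Tendsto (fun n : ℕ => n * σ n) atTop (𝓝 s) →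
      Tendsto (fun n => coeff k (psiSeries (n + 1) (σ n))) atTop (𝓝 (coeff k (normalPsi s))) := by
    intro σ hσ
    cases k with
    | zero => simp only [coeff_zero_psiSeries, coeff_zero_normalPsi, tendsto_const_nhds]
    | succ k =>
      simp only [coeff_succ_psiSeries, coeff_succ_normalPsi]
      refine (ih k (by omega) σ hσ).2.add (tendsto_finsetSum _ fun p hp => ?_)
      have := Finset.HasAntidiagonal.mem_antidiagonal.1 hp
      exact (ih p.1 (by omega) σ hσ).2.mul (ih p.2 (by omega) σ hσ).1
  intro σ hσ
  refine ⟨hψ σ hσ, ?_⟩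
  rcases Nat.eq_zero_or_pos k with rfl | hk
  · simp only [coeff_zero_ratioSeries, coeff_zero_normalExp]
    refine (Real.continuous_exp.tendsto _).comp (Tendsto.div_const ?_ 2)
    simpa only [mul_comm] using hσ
  have hk0 : (k : ℝ) ≠ 0 := by positivity
  have hshift : ∀ i ≤ k, Tendsto (fun n => coeff i (psiSeries n (σ n))) atTop
      (𝓝 (coeff i (normalPsi s))) := by
    intro i hi
    have hσ' : Tendsto (fun n : ℕ => n * σ (n + 1)) atTop (𝓝 s) := by
      have h1 := (tendsto_add_atTop_iff_nat 1).2 hσ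
      have h2 := h1.mul (tendsto_natCast_div_add_atTop (1 : ℝ))
      rw [mul_one] at h2
      refine h2.congr fun n => ?_
      have : (n : ℝ) + 1 ≠ 0 := by positivity
      push_cast
      field_simp
    refine (tendsto_add_atTop_iff_nat 1).1 ?_
    rcases hi.lt_or_eq with hi | rfl
    · exact (ih i hi _ hσ').1
    · exact hψ _ hσ'
  have hmain : Tendsto (fun n => (k : ℝ) * coeff k (ratioSeries n (σ n))) atTop
      (𝓝 ((k : ℝ) * coeff k (normalExp s))) := by
    simp only [natCast_mul_coeff_ratioSeries, natCast_mul_coeff_normalExp]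
    refine tendsto_finsetSum _ fun p hp => ?_
    have hp' := Finset.HasAntidiagonal.mem_antidiagonal.1 hp
    rcases Nat.eq_zero_or_pos p.1 with h0 | h0
    · simp [h0]
    have := ((tendsto_natCast_mul_exp_sub_exp hσ p.1).mul (hshift p.1 (by omega))).mul
      (ih p.2 (by omega) σ hσ).2
    rwa [mul_assoc s] at this
  have := hmain.const_mul (k : ℝ)⁻¹
  simpa only [inv_mul_cancel_left₀ hk0] using this

/-! ### Majorants for the moments when `s ≥ 0` -/

theorem coeff_normalPsi_nonneg {s : ℝ} (hs : 0 ≤ s) (k : ℕ) : 0 ≤ coeff k (normalPsi s) := by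
  rcases Nat.eq_zero_or_pos k with rfl | hk
  · rw [coeff_zero_normalPsi]
  · rw [coeff_normalPsi s hk, coeff_momentSeries s hk]
    positivity

theorem coeff_normalExp_nonneg {s : ℝ} (hs : 0 ≤ s) (k : ℕ) : 0 ≤ coeff k (normalExp s) := by
  induction k using Nat.strong_induction_on with
  | _ k ih =>
    rcases Nat.eq_zero_or_pos k with rfl | hk
    · rw [coeff_zero_normalExp]; positivity
    · have hk0 : (0 : ℝ) < k := by exact_mod_cast hk
      refine nonneg_of_mul_nonneg_right (a := (k : ℝ)) ?_ hk0
      rw [natCast_mul_coeff_normalExp]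
      refine Finset.sum_nonneg fun p hp => ?_
      have hp' := Finset.HasAntidiagonal.mem_antidiagonal.1 hp
      have h1 := coeff_normalPsi_nonneg hs p.1
      rcases Nat.eq_zero_or_pos p.1 with h0 | h0
      · simp [h0]
      have h2 := ih p.2 (by omega)
      positivity

/-- The base `2 e^{2s}` collects `2` from the binomials, `e^s` from the exponential sum, `e^{s/2}`
from the moment formula and `e^{s/2}` from the factor on the left, which is the loss in
`abs_coeff_psiSeries_le` when `(m + 1) σ = s`. -/
theorem coeff_normalPsi_le {s : ℝ} (hs : 0 ≤ s) (k : ℕ) :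
    Real.exp (s * k / 2) * coeff k (normalPsi s) ≤ (2 * Real.exp (2 * s)) ^ k := by
  rcases Nat.eq_zero_or_pos k with rfl | hk
  · rw [coeff_zero_normalPsi]; simp
  rw [coeff_normalPsi s hk, coeff_momentSeries s hk]
  have h1 : ∑ j ∈ Finset.range k, (k.choose (j + 1) : ℝ) * ((s * k) ^ j / (j.factorial : ℝ)) ≤
      2 ^ k * Real.exp (s * k) := by
    calc _ ≤ ∑ j ∈ Finset.range k, (2 : ℝ) ^ k * ((s * k) ^ j / (j.factorial : ℝ)) := by
          refine Finset.sum_le_sum fun j _ => ?_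
          have : (k.choose (j + 1) : ℝ) ≤ 2 ^ k := by exact_mod_cast Nat.choose_le_two_pow k (j + 1)
          gcongr
      _ ≤ _ := by
          rw [← Finset.mul_sum]
          gcongr
          exact Real.sum_le_exp_of_nonneg (by positivity) k
  have h2 : Real.exp (s * k / 2) / k ≤ Real.exp (s * k / 2) :=
    div_le_self (Real.exp_pos _).le (by exact_mod_cast hk)
  calc _ ≤ Real.exp (s * k / 2) * (Real.exp (s * k / 2) * (2 ^ k * Real.exp (s * k))) := by
        gcongr
    _ = _ := by
        rw [mul_pow, ← Real.exp_nat_mul, mul_left_comm (Real.exp (s * k / 2)) (2 ^ k),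
          mul_left_comm (Real.exp (s * k / 2)) (2 ^ k), ← Real.exp_add, ← Real.exp_add]
        ring_nf

theorem natCast_mul_exp_sub_exp_le {s σ : ℝ} {m : ℕ} (hm : m * σ ≤ s) (i : ℕ) :
    (m : ℝ) * (Real.exp (i * (σ / 2)) - Real.exp (i * (-(σ / 2)))) ≤
      s * i * Real.exp (i * (σ / 2)) := by
  have h1 : Real.exp (i * (-(σ / 2))) = Real.exp (i * (σ / 2)) * Real.exp (-(i * σ)) := by
    rw [← Real.exp_add]; congr 1; ring
  have h2 := Real.add_one_le_exp (-(i * σ))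
  have h3 : 1 - Real.exp (-(i * σ)) ≤ i * σ := by linarith
  rw [h1]
  calc _ = Real.exp (i * (σ / 2)) * (m * (1 - Real.exp (-(i * σ)))) := by ring
    _ ≤ Real.exp (i * (σ / 2)) * (m * (i * σ)) := by gcongr
    _ = Real.exp (i * (σ / 2)) * (i * (m * σ)) := by ring
    _ ≤ Real.exp (i * (σ / 2)) * (i * s) := by gcongr
    _ = _ := by ring

/-- The recursion at finite `n` is majorized by the limit recursion, whose terms are nonnegative.
The discrete derivative exceeds its limit by at most a factor `q^i` in degree `i`, which is the step
from `q^(m i)` to `q^((m+1) i)`. As `(m + 1) σ ≤ s`, the accumulated factor is at most `e^{sk/2}`,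
uniformly in `m`. -/
theorem abs_coeff_psiSeries_le {s σ : ℝ} (hσ : 0 ≤ σ) (m : ℕ) (hm : (m + 1 : ℕ) * σ ≤ s) (k : ℕ) :
    |coeff k (psiSeries (m + 1) σ)| ≤
      Real.exp (σ / 2) ^ ((m + 1) * k) * coeff k (normalPsi s) := by
  have hs : 0 ≤ s := le_trans (by positivity) hm
  have hq : 1 ≤ Real.exp (σ / 2) := Real.one_le_exp (by positivity)
  set q := Real.exp (σ / 2) with hqdef
  induction m using Nat.strong_induction_on generalizing k with
  | _ m ihm =>
  have hmσ : (m : ℝ) * σ ≤ s := le_trans (by push_cast; nlinarith) hm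
  -- The factor `m`, present in the recursion anyway, makes the case `m = 0` trivial, where the
  -- induction hypothesis says nothing.
  have ih : ∀ k, (m : ℝ) * |coeff k (psiSeries m σ)| ≤
      m * (q ^ (m * k) * coeff k (normalPsi s)) := by
    intro k
    cases m with
    | zero => simp
    | succ m => gcongr; exact ihm m (by omega) hmσ k
  have hg : ∀ k, |coeff k (ratioSeries m σ)| ≤ q ^ ((m + 1) * k) * coeff k (normalExp s) := by
    intro k
    induction k using Nat.strong_induction_on with
    | _ k ihk =>
    rcases Nat.eq_zero_or_pos k with rfl | hk
    · rw [coeff_zero_ratioSeries, coeff_zero_normalExp, mul_zero, pow_zero, one_mul,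
        abs_of_pos (Real.exp_pos _)]
      exact Real.exp_le_exp.2 (by linarith)
    have hk0 : (0 : ℝ) < k := by exact_mod_cast hk
    refine le_of_mul_le_mul_left ?_ hk0
    rw [← abs_of_pos hk0, ← abs_mul, abs_of_pos hk0, natCast_mul_coeff_ratioSeries, mul_left_comm,
      natCast_mul_coeff_normalExp, Finset.mul_sum]
    refine (Finset.abs_sum_le_sum_abs _ _).trans (Finset.sum_le_sum fun p hp => ?_)
    have hp' := Finset.HasAntidiagonal.mem_antidiagonal.1 hp
    rcases Nat.eq_zero_or_pos p.1 with h0 | h0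
    · simp [h0]
    have hd : 0 ≤ Real.exp (p.1 * (σ / 2)) - Real.exp (p.1 * (-(σ / 2))) := by
      rw [sub_nonneg, Real.exp_le_exp]
      have : (0 : ℝ) ≤ p.1 * σ := by positivity
      linarith
    have hexp : Real.exp (p.1 * (σ / 2)) = q ^ p.1 := Real.exp_nat_mul _ _
    have hE := coeff_normalExp_nonneg hs p.2
    have hP := coeff_normalPsi_nonneg hs p.1
    have h1 := ih p.1
    have h2 := ihk p.2 (by omega)
    have h3 := natCast_mul_exp_sub_exp_le hmσ p.1
    rw [abs_mul, abs_mul, abs_mul, abs_of_nonneg hd, Nat.abs_cast]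
    calc _ = (Real.exp (p.1 * (σ / 2)) - Real.exp (p.1 * (-(σ / 2)))) *
            (m * |coeff p.1 (psiSeries m σ)|) * |coeff p.2 (ratioSeries m σ)| := by ring
      _ ≤ (Real.exp (p.1 * (σ / 2)) - Real.exp (p.1 * (-(σ / 2)))) *
            (m * (q ^ (m * p.1) * coeff p.1 (normalPsi s))) *
            (q ^ ((m + 1) * p.2) * coeff p.2 (normalExp s)) := by gcongr
      _ = (m * (Real.exp (p.1 * (σ / 2)) - Real.exp (p.1 * (-(σ / 2))))) *
            (q ^ (m * p.1) * coeff p.1 (normalPsi s) *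
            (q ^ ((m + 1) * p.2) * coeff p.2 (normalExp s))) := by ring
      _ ≤ (s * p.1 * Real.exp (p.1 * (σ / 2))) *
            (q ^ (m * p.1) * coeff p.1 (normalPsi s) *
            (q ^ ((m + 1) * p.2) * coeff p.2 (normalExp s))) := by gcongr
      _ = _ := by
        rw [hexp, show (m + 1) * k = p.1 + m * p.1 + (m + 1) * p.2 by rw [← hp']; ring,
          pow_add, pow_add]
        ring
  induction k using Nat.strong_induction_on with
  | _ k ihk =>
  cases k with
  | zero => simp [coeff_zero_psiSeries, coeff_zero_normalPsi]
  | succ k =>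
    have hstep : |coeff (k + 1) (psiSeries (m + 1) σ)| ≤
        q ^ ((m + 1) * k) * coeff (k + 1) (normalPsi s) := by
      rw [coeff_succ_psiSeries, coeff_succ_normalPsi, mul_add, Finset.mul_sum]
      refine (abs_add_le _ _).trans (add_le_add (hg k) ?_)
      refine (Finset.abs_sum_le_sum_abs _ _).trans (Finset.sum_le_sum fun p hp => ?_)
      have hp' := Finset.HasAntidiagonal.mem_antidiagonal.1 hp
      have hE := coeff_normalExp_nonneg hs p.1
      rw [abs_mul, ← hp', mul_add, pow_add, mul_mul_mul_comm]
      have h1 := hg p.1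
      have h2 := ihk p.2 (by omega)
      gcongr
    refine hstep.trans ?_
    have := coeff_normalPsi_nonneg hs (k + 1)
    gcongr
    exact Nat.le_succ k

end Recursion

/-! ### Symmetry and power sums of the zeros -/

section Zeros

open Polynomial

theorem monic_multHermite (n : ℕ) (s : ℂ) : (multHermite n s).Monic := by
  rw [Monic, leadingCoeff, natDegree_multHermite, coeff_multHermite, if_pos le_rfl]
  simp [pow_two]

theorem multHermite_eq_prod_roots (n : ℕ) (s : ℂ) :
    multHermite n s = ((multHermite n s).roots.map fun z => X - C z).prod :=
  (IsAlgClosed.splits _).eq_prod_roots_of_monic (monic_multHermite n s)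

theorem card_roots_multHermite (n : ℕ) (s : ℂ) : (multHermite n s).roots.card = n := by
  rw [IsAlgClosed.card_roots_eq_natDegree, natDegree_multHermite]

theorem multHermite_zero (s : ℂ) : multHermite 0 s = 1 := by
  simp [multHermite]

theorem multHermite_succ (n : ℕ) (s : ℂ) :
    multHermite (n + 1) s =
      X * (C (Complex.exp (s * n / 2)) * (multHermite n s).comp (C (Complex.exp (-(s / 2))) * X)) -
        (multHermite n s).comp (C (Complex.exp (s / 2)) * X) := by
  ext j
  cases j with
  | zero =>
    rw [coeff_sub, mul_coeff_zero, coeff_X_zero, zero_mul, comp_C_mul_X_coeff, coeff_multHermite,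
      coeff_multHermite]
    simp [pow_succ]
  | succ j =>
    rw [coeff_sub, coeff_X_mul, coeff_C_mul, comp_C_mul_X_coeff, comp_C_mul_X_coeff,
      coeff_multHermite, coeff_multHermite, coeff_multHermite, ← Complex.exp_nat_mul,
      ← Complex.exp_nat_mul]
    have h1 : Complex.exp (-(s / 2) *
          (((j + 1 : ℕ) : ℂ) ^ 2 - ((n + 1 : ℕ) : ℂ) * ((j + 1 : ℕ) : ℂ))) =
        Complex.exp ((j + 1 : ℕ) * (s / 2)) *
          Complex.exp (-(s / 2) * (((j + 1 : ℕ) : ℂ) ^ 2 - n * ((j + 1 : ℕ) : ℂ))) := by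
      rw [← Complex.exp_add]; congr 1; push_cast; ring
    have h2 : Complex.exp (-(s / 2) *
          (((j + 1 : ℕ) : ℂ) ^ 2 - ((n + 1 : ℕ) : ℂ) * ((j + 1 : ℕ) : ℂ))) =
        Complex.exp (s * n / 2) * (Complex.exp (j * (-(s / 2))) *
          Complex.exp (-(s / 2) * ((j : ℂ) ^ 2 - n * j))) := by
      rw [← Complex.exp_add, ← Complex.exp_add]; congr 1; push_cast; ring
    rcases lt_trichotomy j n with hj | rfl | hj
    · rw [if_pos (by omega), if_pos (by omega), if_pos (by omega), Nat.choose_succ_succ' n j,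
        Nat.cast_add, mul_add, add_mul, Nat.add_sub_add_right]
      obtain ⟨d, rfl⟩ := Nat.exists_eq_add_of_lt hj
      rw [show j + d + 1 - j = d + 1 by omega, show j + d + 1 - (j + 1) = d by omega]
      nth_rw 1 [h2]
      rw [h1, pow_succ]
      ring
    · rw [if_pos le_rfl, if_pos le_rfl, if_neg (by omega), h2]
      simp only [Nat.sub_self, Nat.choose_self]
      ring
    · rw [if_neg (by omega), if_neg (by omega), if_neg (by omega)]
      simp

theorem eval_multHermite_succ (n : ℕ) (s x : ℂ) :
    (multHermite (n + 1) s).eval x =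
      x * (Complex.exp (s * n / 2) * (multHermite n s).eval (Complex.exp (-(s / 2)) * x)) -
        (multHermite n s).eval (Complex.exp (s / 2) * x) := by
  rw [multHermite_succ]
  simp

/-! Palindromic symmetry. -/

/-- The exponent `j² - nj = -j(n - j)` and the binomial coefficient are invariant under `j ↦ n - j`;
only the sign changes. -/
theorem reverse_multHermite (n : ℕ) (s : ℂ) :
    (multHermite n s).reverse = C ((-1) ^ n) * multHermite n s := by
  ext j
  rw [coeff_reverse, natDegree_multHermite, coeff_C_mul]
  rcases le_or_gt j n with hj | hj
  · obtain ⟨d, rfl⟩ := Nat.exists_eq_add_of_le hj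
    rw [revAt_le hj, coeff_multHermite, coeff_multHermite, if_pos (by omega), if_pos hj,
      show j + d - j = d by omega, show j + d - d = j by omega, Nat.choose_symm_add, pow_add]
    have : (-1 : ℂ) ^ d * (-1) ^ d = 1 := by rw [← mul_pow]; simp
    have h2 : -(s / 2) * ((d : ℂ) ^ 2 - ((j + d : ℕ) : ℂ) * d) =
        -(s / 2) * ((j : ℂ) ^ 2 - ((j + d : ℕ) : ℂ) * j) := by push_cast; ring
    rw [h2]
    linear_combination (-(-1 : ℂ) ^ j * ((j + d).choose d : ℂ) *
      Complex.exp (-(s / 2) * ((j : ℂ) ^ 2 - ((j + d : ℕ) : ℂ) * j))) * this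
  · rw [revAt_eq_self_of_lt hj, coeff_multHermite, if_neg (by omega), mul_zero]

theorem reverse_prod_X_sub_C (m : Multiset ℂ) :
    (m.map fun z => X - C z).prod.reverse = (m.map fun z => 1 - C z * X).prod := by
  induction m using Multiset.induction_on with
  | empty =>
    have h := reverse_C (1 : ℂ)
    rw [C_1] at h
    simpa using h
  | cons a m ih =>
    rw [Multiset.map_cons, Multiset.prod_cons, reverse_mul_of_domain, ih, Multiset.map_cons,
      Multiset.prod_cons]
    congr 1
    rw [reverse, natDegree_X_sub_C, reflect_sub, reflect_one_X, reflect_C, pow_one]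

theorem zero_notMem_roots_multHermite (n : ℕ) (s : ℂ) : (0 : ℂ) ∉ (multHermite n s).roots := by
  intro h
  have := isRoot_of_mem_roots h
  rw [IsRoot, ← coeff_zero_eq_eval_zero, coeff_multHermite, if_pos (Nat.zero_le _)] at this
  simp at this

theorem prod_one_sub_C_mul_X (m : Multiset ℂ) (hm : (0 : ℂ) ∉ m) :
    (m.map fun z => 1 - C z * X).prod =
      C (m.map fun z => -z).prod * ((m.map fun z => z⁻¹).map fun z => X - C z).prod := by
  induction m using Multiset.induction_on with
  | empty => simp
  | cons a m ih =>
    rw [Multiset.mem_cons, not_or] at hm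
    simp only [Multiset.map_cons, Multiset.prod_cons, C_mul]
    rw [ih hm.2]
    have : (1 : ℂ[X]) = C a * C a⁻¹ := by rw [← C_mul, mul_inv_cancel₀ (Ne.symm hm.1), C_1]
    rw [this, C_neg]
    ring

theorem map_inv_roots_multHermite (n : ℕ) (s : ℂ) :
    (multHermite n s).roots.map (fun z => z⁻¹) = (multHermite n s).roots := by
  set m := (multHermite n s).roots with hm
  have h0 : (0 : ℂ) ∉ m := zero_notMem_roots_multHermite n s
  have h1 := reverse_multHermite n s
  rw [multHermite_eq_prod_roots, ← hm, reverse_prod_X_sub_C, prod_one_sub_C_mul_X m h0] at h1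
  have h2 := congrArg Polynomial.roots h1
  have h3 : (m.map fun z => -z).prod ≠ 0 := by
    refine Multiset.prod_ne_zero ?_
    simpa using h0
  rwa [roots_C_mul _ h3, roots_multiset_prod_X_sub_C, roots_C_mul _ (by simp),
    roots_multiset_prod_X_sub_C] at h2

/-! Power sums of the zeros. -/

open PowerSeries in
-- Newton's identities as a logarithmic derivative: a factor `1 - at` contributes `at / (1 - at) =
-- ∑_{k ≥ 1} a^k t^k`.
theorem mk_powerSum_mul_prod (m : Multiset ℂ) :
    PowerSeries.mk (fun k => if k = 0 then 0 else (m.map fun z => z ^ k).sum) *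
        (m.map fun z => (1 - PowerSeries.C z * PowerSeries.X : ℂ⟦X⟧)).prod =
      -(PowerSeries.X *
        d⁄dX ℂ (m.map fun z => (1 - PowerSeries.C z * PowerSeries.X : ℂ⟦X⟧)).prod) := by
  induction m using Multiset.induction_on with
  | empty =>
    have : PowerSeries.mk (fun _ : ℕ => (0 : ℂ)) = 0 := by ext; simp
    simp [this]
  | cons a m ih =>
    set N := PowerSeries.mk (fun k => if k = 0 then 0 else (m.map fun z => z ^ k).sum)
    set Q := (m.map fun z => (1 - PowerSeries.C z * PowerSeries.X : ℂ⟦X⟧)).prod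
    set A := PowerSeries.mk (fun k => if k = 0 then 0 else a ^ k)
    have h1 : PowerSeries.mk (fun k => if k = 0 then 0 else ((a ::ₘ m).map fun z => z ^ k).sum) =
        A + N := by
      ext k
      by_cases hk : k = 0 <;> simp [A, N, hk]
    have h2 : A * (1 - PowerSeries.C a * PowerSeries.X) = PowerSeries.C a * PowerSeries.X := by
      ext k
      rw [mul_sub, mul_one, map_sub, mul_left_comm, PowerSeries.coeff_C_mul,
        PowerSeries.coeff_C_mul]
      rcases k with _ | _ | k
      · simp [A]
      · rw [PowerSeries.coeff_succ_mul_X]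
        simp [A]
      · rw [PowerSeries.coeff_succ_mul_X]
        simp [A, PowerSeries.coeff_X, pow_succ]
        ring
    rw [h1, Multiset.map_cons, Multiset.prod_cons, Derivation.leibniz, map_sub,
      Derivation.map_one_eq_zero, Derivation.leibniz, PowerSeries.derivative_C,
      PowerSeries.derivative_X]
    simp only [smul_eq_mul]
    linear_combination (1 - PowerSeries.C a * PowerSeries.X) * ih + Q * h2

theorem coe_prod_one_sub_C_mul_X (m : Multiset ℂ) :
    (((m.map fun z => (1 - C z * X : ℂ[X])).prod : ℂ[X]) : PowerSeries ℂ) =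
      (m.map fun z => (1 - PowerSeries.C z * PowerSeries.X : PowerSeries ℂ)).prod := by
  induction m using Multiset.induction_on with
  | empty => simp
  | cons a m ih => simp [ih]

theorem coe_prod_roots_eq_map_hermiteSeries (n : ℕ) (σ : ℝ) :
    ((multHermite n (σ : ℂ)).roots.map
        fun z => (1 - PowerSeries.C z * PowerSeries.X : PowerSeries ℂ)).prod =
      PowerSeries.map Complex.ofRealHom (hermiteSeries n σ) := by
  rw [← coe_prod_one_sub_C_mul_X, ← reverse_prod_X_sub_C, ← multHermite_eq_prod_roots,
    reverse_multHermite]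
  ext j
  rw [Polynomial.coeff_coe, coeff_C_mul, coeff_multHermite, PowerSeries.coeff_map, hermiteSeries,
    PowerSeries.coeff_mk]
  rcases le_or_gt j n with hj | hj
  · obtain ⟨d, rfl⟩ := Nat.exists_eq_add_of_le hj
    rw [if_pos hj, show j + d - j = d by omega, pow_add]
    have : (-1 : ℂ) ^ d * (-1) ^ d = 1 := by rw [← mul_pow]; simp
    simp only [Complex.ofRealHom_eq_coe]
    push_cast
    linear_combination ((-1 : ℂ) ^ j * ((j + d).choose j : ℂ) *
      Complex.exp (-((σ : ℂ) / 2) * ((j : ℂ) ^ 2 - ((j : ℂ) + d) * j))) * this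
  · rw [if_neg (by omega), Nat.choose_eq_zero_of_lt hj]
    simp

theorem sum_pow_roots_multHermite (n : ℕ) (σ : ℝ) {k : ℕ} (hk : k ≠ 0) :
    ((multHermite n (σ : ℂ)).roots.map fun z => z ^ k).sum =
      ((n * PowerSeries.coeff k (psiSeries n σ) : ℝ) : ℂ) := by
  have h1 := mk_powerSum_mul_prod (multHermite n (σ : ℂ)).roots
  rw [coe_prod_roots_eq_map_hermiteSeries] at h1
  have h2 : PowerSeries.X * PowerSeries.derivative ℂ
        (PowerSeries.map Complex.ofRealHom (hermiteSeries n σ)) =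
      PowerSeries.map Complex.ofRealHom
        (PowerSeries.X * PowerSeries.derivative ℝ (hermiteSeries n σ)) := by
    ext j
    rw [coeff_X_mul_derivative, PowerSeries.coeff_map, PowerSeries.coeff_map,
      coeff_X_mul_derivative]
    simp
  rw [h2, X_mul_derivative_hermiteSeries, map_neg, neg_neg, map_mul] at h1
  have hne : PowerSeries.map Complex.ofRealHom (hermiteSeries n σ) ≠ 0 := by
    intro h
    refine hermiteSeries_ne_zero n σ (PowerSeries.map_injective _ Complex.ofRealHom.injective ?_)
    rw [h, map_zero]
  have h3 := congrArg (PowerSeries.coeff k) (mul_right_cancel₀ hne h1)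
  rw [PowerSeries.coeff_mk, if_neg hk, PowerSeries.coeff_map,
    ← map_natCast (PowerSeries.C (R := ℝ)),
    PowerSeries.coeff_C_mul] at h3
  exact h3

end Zeros

/-! ### Location of the zeros -/

section Location

open Polynomial

/-! Zeros on the unit circle for `σ ≤ 0`. -/

/-- The Blaschke-factor identity: for `c ≥ 1` the sign depends only on which side of the unit circle
`x` lies, so it can be applied factor by factor. -/
theorem norm_sub_mul_sq (c : ℝ) {x z : ℂ} (hz : ‖z‖ = 1) :
    ‖c * x - z‖ ^ 2 - ‖x - c * z‖ ^ 2 = (c ^ 2 - 1) * (‖x‖ ^ 2 - 1) := by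
  have h1 : z.re * z.re + z.im * z.im = 1 := by
    rw [← Complex.normSq_apply, Complex.normSq_eq_norm_sq, hz, one_pow]
  simp only [← Complex.normSq_eq_norm_sq, Complex.normSq_apply, Complex.sub_re, Complex.sub_im,
    Complex.mul_re, Complex.mul_im, Complex.ofReal_re, Complex.ofReal_im]
  linear_combination (1 - c ^ 2) * h1

theorem norm_prod_sub_le_of_one_le_norm {c : ℝ} (hc : 1 ≤ c) {x : ℂ} (hx : 1 ≤ ‖x‖)
    (m : Multiset ℂ) (hm : ∀ z ∈ m, ‖z‖ = 1) :
    ‖(m.map fun z => x - c * z).prod‖ ≤ ‖(m.map fun z => c * x - z).prod‖ := by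
  induction m using Multiset.induction_on with
  | empty => simp
  | cons a m ih =>
    simp only [Multiset.map_cons, Multiset.prod_cons, norm_mul]
    refine mul_le_mul ?_ (ih fun z hz => hm z (Multiset.mem_cons_of_mem hz)) (norm_nonneg _)
      (norm_nonneg _)
    refine le_of_sq_le_sq ?_ (norm_nonneg _)
    have h := norm_sub_mul_sq c (x := x) (hm a (Multiset.mem_cons_self a m))
    have : 0 ≤ (c ^ 2 - 1) * (‖x‖ ^ 2 - 1) := mul_nonneg (by nlinarith) (by nlinarith)
    linarith

theorem norm_prod_sub_le_of_norm_le_one {c : ℝ} (hc : 1 ≤ c) {x : ℂ} (hx : ‖x‖ ≤ 1)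
    (m : Multiset ℂ) (hm : ∀ z ∈ m, ‖z‖ = 1) :
    ‖(m.map fun z => c * x - z).prod‖ ≤ ‖(m.map fun z => x - c * z).prod‖ := by
  induction m using Multiset.induction_on with
  | empty => simp
  | cons a m ih =>
    simp only [Multiset.map_cons, Multiset.prod_cons, norm_mul]
    refine mul_le_mul ?_ (ih fun z hz => hm z (Multiset.mem_cons_of_mem hz)) (norm_nonneg _)
      (norm_nonneg _)
    refine le_of_sq_le_sq ?_ (norm_nonneg _)
    have h := norm_sub_mul_sq c (x := x) (hm a (Multiset.mem_cons_self a m))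
    have : 0 ≤ (c ^ 2 - 1) * (1 - ‖x‖ ^ 2) :=
      mul_nonneg (by nlinarith) (by nlinarith [norm_nonneg x])
    linarith

theorem eval_multHermite (n : ℕ) (s x : ℂ) :
    (multHermite n s).eval x = ((multHermite n s).roots.map fun z => x - z).prod := by
  conv_lhs => rw [multHermite_eq_prod_roots]
  rw [eval_multiset_prod, Multiset.map_map]
  simp

theorem pow_card_mul_prod_inv_mul_sub (m : Multiset ℂ) (x : ℂ) {c : ℂ} (hc : c ≠ 0) :
    c ^ m.card * (m.map fun z => c⁻¹ * x - z).prod = (m.map fun z => x - c * z).prod := by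
  induction m using Multiset.induction_on with
  | empty => simp
  | cons a m ih =>
    simp only [Multiset.map_cons, Multiset.prod_cons, Multiset.card_cons, ← ih]
    have : x = c * (c⁻¹ * x) := by field_simp
    conv_rhs => rw [this]
    rw [← this, pow_succ]
    have : x - c * a = c * (c⁻¹ * x - a) := by field_simp
    rw [this]
    ring

theorem eval_mul_multHermite (n : ℕ) (s x c : ℂ) (hc : c ≠ 0) :
    c ^ n * (multHermite n s).eval (c⁻¹ * x) =
      ((multHermite n s).roots.map fun z => x - c * z).prod := by
  have h := pow_card_mul_prod_inv_mul_sub (multHermite n s).roots x hc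
  rwa [card_roots_multHermite, ← eval_multHermite] at h

/-- For real `σ`, a zero `x` of `H_{n+1}^*(·; σ)` satisfies
`|x| ∏ |c x - z| = ∏ |x - c z|`, with `c = e^{-σ/2}` and `z` the zeros of `H_n^*(·; σ)`. -/
theorem norm_eq_of_mem_roots_succ {n : ℕ} {σ : ℝ} {x : ℂ}
    (hx : x ∈ (multHermite (n + 1) (σ : ℂ)).roots) :
    ‖x‖ * ‖((multHermite n (σ : ℂ)).roots.map
        fun z => (Real.exp (-(σ / 2)) : ℂ) * x - z).prod‖ =
      ‖((multHermite n (σ : ℂ)).roots.map fun z => x - (Real.exp (-(σ / 2)) : ℂ) * z).prod‖ := by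
  have h1 := isRoot_of_mem_roots hx
  rw [IsRoot, eval_multHermite_succ, sub_eq_zero] at h1
  have h2 : (Complex.exp ((σ : ℂ) / 2)) = (Complex.exp (-((σ : ℂ) / 2)))⁻¹ := by
    rw [Complex.exp_neg, inv_inv]
  have h3 : Complex.exp (σ * n / 2) = (Complex.exp (-((σ : ℂ) / 2)) ^ n)⁻¹ := by
    rw [← inv_pow, ← h2, ← Complex.exp_nat_mul]; congr 1; ring
  have hc : ((Real.exp (-(σ / 2)) : ℝ) : ℂ) = Complex.exp (-((σ : ℂ) / 2)) := by push_cast; rfl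
  have hne := Complex.exp_ne_zero (-((σ : ℂ) / 2))
  rw [hc, ← eval_mul_multHermite _ _ _ _ hne, ← eval_multHermite, ← norm_mul, ← h2, ← h1, h3]
  congr 1
  field_simp

/-- In `|x| ∏|cx - z| = ∏|x - cz|`, a point with `|x| < 1` makes the left product at most the right
one, and the factor `|x|` then contradicts equality; `|x| > 1` is symmetric. Strictness needs a
nonzero product, which holds since `|cz| ≥ 1 > |x|` in the first case and `|cx| > 1 = |z|` in the
second. -/
theorem norm_eq_one_of_mem_roots_multHermite {σ : ℝ} (hσ : σ ≤ 0) (n : ℕ) :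
    ∀ x ∈ (multHermite n (σ : ℂ)).roots, ‖x‖ = 1 := by
  induction n with
  | zero => simp [multHermite_zero]
  | succ n ih =>
    intro x hx
    have hc : 1 ≤ Real.exp (-(σ / 2)) := Real.one_le_exp (by linarith)
    have h := norm_eq_of_mem_roots_succ hx
    set m := (multHermite n (σ : ℂ)).roots
    set c := Real.exp (-(σ / 2))
    rcases lt_trichotomy ‖x‖ 1 with hlt | heq | hgt
    · exfalso
      have h1 := norm_prod_sub_le_of_norm_le_one hc hlt.le m ih
      have h2 : 0 < ‖(m.map fun z => x - c * z).prod‖ := by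
        rw [norm_pos_iff]
        refine Multiset.prod_ne_zero fun h0 => ?_
        obtain ⟨z, hz, hz0⟩ := Multiset.mem_map.1 h0
        have := congrArg norm (sub_eq_zero.1 hz0)
        rw [norm_mul, ih z hz, Complex.norm_real, Real.norm_of_nonneg (Real.exp_pos _).le] at this
        linarith
      nlinarith [norm_nonneg x]
    · exact heq
    · exfalso
      have h1 := norm_prod_sub_le_of_one_le_norm hc hgt.le m ih
      have h2 : 0 < ‖(m.map fun z => c * x - z).prod‖ := by
        rw [norm_pos_iff]
        refine Multiset.prod_ne_zero fun h0 => ?_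
        obtain ⟨z, hz, hz0⟩ := Multiset.mem_map.1 h0
        have := congrArg norm (sub_eq_zero.1 hz0)
        rw [norm_mul, ih z hz, Complex.norm_real, Real.norm_of_nonneg (Real.exp_pos _).le] at this
        nlinarith
      nlinarith

/-! Zeros on the positive half-line for `σ > 0`. -/

theorem neg_one_pow_mul_prod_pos {n j : ℕ} (hj : j ≤ n) {z : ℕ → ℝ} {x : ℝ}
    (h1 : ∀ i < j, z i < x) (h2 : ∀ i, j ≤ i → i < n → x < z i) :
    0 < (-1) ^ (n - j) * ∏ i ∈ Finset.range n, (x - z i) := by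
  induction n, hj using Nat.le_induction with
  | base =>
    rw [Nat.sub_self, pow_zero, one_mul]
    exact Finset.prod_pos fun i hi => sub_pos.2 (h1 i (Finset.mem_range.1 hi))
  | succ n hn ih =>
    have h3 := ih fun i hi hin => h2 i hi (by omega)
    have h4 := h2 n hn (by omega)
    rw [Finset.prod_range_succ, Nat.succ_sub hn, pow_succ]
    have := mul_pos h3 (sub_pos.2 h4)
    linarith

theorem mul_sq_lt_of_separated {q : ℝ} (hq : 1 < q) {n : ℕ} {z : ℕ → ℝ}
    (hpos : ∀ i < n, 0 < z i) (hsep : ∀ i, i + 1 < n → q ^ 2 * z i < z (i + 1)) {i j : ℕ}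
    (hij : i < j) (hj : j < n) : q ^ 2 * z i < z j := by
  induction j, hij using Nat.le_induction with
  | base => exact hsep i hj
  | succ j hij ih =>
    have h1 := ih (by omega)
    have h2 := hsep j hj
    have h3 := hpos j (by omega)
    nlinarith [mul_pos (sub_pos.2 hq) h3, mul_pos (mul_pos (sub_pos.2 hq) h3) (by linarith : 0 < q)]

theorem exists_pos_lt_mul_prod_sub {q : ℝ} (hq : 1 < q) {n : ℕ} {z : ℕ → ℝ}
    (hpos : ∀ i < n, 0 < z i) (b : ℝ) :
    ∃ x, b < x ∧ 0 < x * (q ^ n * ∏ i ∈ Finset.range n, (q⁻¹ * x - z i)) -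
      ∏ i ∈ Finset.range n, (q * x - z i) := by
  have hq0 : 0 < q := by linarith
  have hS : ∀ i < n, z i ≤ ∑ i ∈ Finset.range n, z i := fun i hi =>
    Finset.single_le_sum (f := z) (fun j hj => (hpos j (Finset.mem_range.1 hj)).le)
      (Finset.mem_range.2 hi)
  have hS0 : 0 ≤ ∑ i ∈ Finset.range n, z i :=
    Finset.sum_nonneg fun j hj => (hpos j (Finset.mem_range.1 hj)).le
  set S := ∑ i ∈ Finset.range n, z i
  -- As `x ≥ 2q z_i`, each factor satisfies `qx - z_i ≤ 2q (x - q z_i)`; as `x > (2q)^n`, the extra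
  -- factor `x` outweighs the resulting constant.
  set x := |b| + 1 + 2 * q * S + (2 * q) ^ n with hx
  have hp : 0 < (2 * q) ^ n := by positivity
  have hqS : 0 ≤ 2 * q * S := by positivity
  have hx0 : 0 < x := by positivity
  refine ⟨x, by linarith [le_abs_self b], ?_⟩
  have h1 : q ^ n * ∏ i ∈ Finset.range n, (q⁻¹ * x - z i) =
      ∏ i ∈ Finset.range n, (x - q * z i) := by
    rw [Finset.pow_eq_prod_const, ← Finset.prod_mul_distrib]
    refine Finset.prod_congr rfl fun i _ => ?_
    rw [mul_sub, mul_inv_cancel_left₀ hq0.ne']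
  have hz : ∀ i < n, 2 * q * z i ≤ 2 * q * S := fun i hi => by have := hS i hi; gcongr
  have h2 : ∀ i ∈ Finset.range n, 0 < x - q * z i := fun i hi => by
    have hi := Finset.mem_range.1 hi
    nlinarith [hz i hi, hpos i hi, abs_nonneg b]
  have h3 : ∏ i ∈ Finset.range n, (q * x - z i) ≤
      (2 * q) ^ n * ∏ i ∈ Finset.range n, (x - q * z i) := by
    rw [Finset.pow_eq_prod_const, ← Finset.prod_mul_distrib]
    refine Finset.prod_le_prod (fun i hi => ?_) fun i hi => ?_
    · have hi' := Finset.mem_range.1 hi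
      nlinarith [h2 i hi, hpos i hi']
    · have hi' := Finset.mem_range.1 hi
      have h4 : 2 * q * z i ≤ x := by linarith [hz i hi', abs_nonneg b]
      nlinarith [hpos i hi', mul_le_mul_of_nonneg_left h4 hq0.le]
  rw [h1, sub_pos]
  refine h3.trans_lt (mul_lt_mul_of_pos_right ?_ (Finset.prod_pos h2))
  linarith [abs_nonneg b]

/-- At `q z_{i-1}` the first product vanishes and at `z_i / q` the second, and separation by `q²`
fixes the sign of the surviving one. Opposite signs give a zero `w_i` with `q z_{i-1} < w_i < z_i /
q`, the outer endpoints being `0` and a large number. Then `q² w_i < q z_i < w_{i+1}`, so the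
separation reproduces itself. -/
theorem exists_separated_zeros {q : ℝ} (hq : 1 < q) {n : ℕ} {z : ℕ → ℝ}
    (hpos : ∀ i < n, 0 < z i) (hsep : ∀ i, i + 1 < n → q ^ 2 * z i < z (i + 1)) :
    ∃ w : ℕ → ℝ, (∀ i < n + 1, 0 < w i) ∧ (∀ i, i + 1 < n + 1 → q ^ 2 * w i < w (i + 1)) ∧
      ∀ i < n + 1, w i * (q ^ n * ∏ k ∈ Finset.range n, (q⁻¹ * w i - z k)) -
        ∏ k ∈ Finset.range n, (q * w i - z k) = 0 := by
  have hq0 : 0 < q := by linarith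
  set f : ℝ → ℝ := fun x => x * (q ^ n * ∏ k ∈ Finset.range n, (q⁻¹ * x - z k)) -
        ∏ k ∈ Finset.range n, (q * x - z k) with hf
  have hcont : Continuous f := by fun_prop
  set a : ℕ → ℝ := fun i => if i = 0 then 0 else q * z (i - 1) with ha
  have ha0 : ∀ i ≤ n, 0 ≤ a i := by
    intro i hi
    rcases Nat.eq_zero_or_pos i with rfl | h0
    · simp [ha]
    · simp only [ha, h0.ne', if_false]
      have := hpos (i - 1) (by omega)
      positivity
  have hlt := fun {i j : ℕ} => mul_sq_lt_of_separated hq hpos hsep (i := i) (j := j)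
  have hq2 : 1 < q ^ 2 := by nlinarith
  have hmono : ∀ i j, i ≤ j → j < n → z i ≤ z j := by
    intro i j hij hj
    rcases hij.lt_or_eq with h | rfl
    · nlinarith [hlt h hj, hpos i (by omega)]
    · exact le_rfl
  have hlow : ∀ i ≤ n, (-1) ^ (n - i) * f (a i) < 0 := by
    intro i hi
    have hfa : f (a i) = -∏ k ∈ Finset.range n, (q * a i - z k) := by
      rcases Nat.eq_zero_or_pos i with rfl | h0
      · simp [hf, ha]
      · have hz : ∏ k ∈ Finset.range n, (q⁻¹ * a i - z k) = 0 := by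
          refine Finset.prod_eq_zero (Finset.mem_range.2 (by omega : i - 1 < n)) ?_
          simp [ha, h0.ne', hq0.ne']
        simp only [hf, hz, mul_zero, zero_sub]
    have := neg_one_pow_mul_prod_pos hi (z := z) (x := q * a i) (fun k hk => by
        have h0 : i ≠ 0 := by omega
        simp only [ha, h0, if_false]
        have h1 := hmono k (i - 1) (by omega) (by omega)
        nlinarith [hpos (i - 1) (by omega)]) (fun k hk hkn => by
        rcases Nat.eq_zero_or_pos i with rfl | h0
        · simpa [ha] using hpos k hkn
        · simp only [ha, h0.ne', if_false]
          have := hlt (show i - 1 < k by omega) hkn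
          nlinarith)
    rw [hfa]
    linarith
  have hup : ∀ i < n, 0 < (-1) ^ (n - i) * f (q⁻¹ * z i) := by
    intro i hi
    have hfb : f (q⁻¹ * z i) = q⁻¹ * z i * q ^ n *
        ∏ k ∈ Finset.range n, (q⁻¹ * (q⁻¹ * z i) - z k) := by
      have hz : ∏ k ∈ Finset.range n, (q * (q⁻¹ * z i) - z k) = 0 := by
        refine Finset.prod_eq_zero (Finset.mem_range.2 hi) ?_
        rw [mul_inv_cancel_left₀ hq0.ne', sub_self]
      simp only [hf, hz]; ring
    have hx : q ^ 2 * (q⁻¹ * (q⁻¹ * z i)) = z i := by field_simp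
    have hx0 : 0 < q⁻¹ * (q⁻¹ * z i) := by have := hpos i hi; positivity
    have := neg_one_pow_mul_prod_pos hi.le (z := z) (x := q⁻¹ * (q⁻¹ * z i)) (fun k hk => by
        have := hlt hk hi
        rw [← hx] at this
        exact lt_of_mul_lt_mul_left this (by positivity)) (fun k hk hkn => by
        have := hmono i k hk hkn
        nlinarith)
    rw [hfb]
    have hc : 0 < q⁻¹ * z i * q ^ n := by have := hpos i hi; positivity
    nlinarith [mul_pos hc this]
  have hroot : ∀ i ≤ n, ∃ w, a i < w ∧ (i < n → w < q⁻¹ * z i) ∧ f w = 0 := by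
    have ivt : ∀ (i : ℕ) (b : ℝ), a i < b → (-1) ^ (n - i) * f (a i) < 0 →
        0 < (-1) ^ (n - i) * f b → ∃ w, a i < w ∧ w < b ∧ f w = 0 := by
      intro i b hab h1 h2
      obtain ⟨w, hw, hfw⟩ := intermediate_value_Ioo hab.le
        (f := fun x => (-1) ^ (n - i) * f x) (by fun_prop) ⟨h1, h2⟩
      refine ⟨w, hw.1, hw.2, ?_⟩
      simpa using hfw
    intro i hi
    rcases hi.lt_or_eq with hi' | rfl
    · have hab : a i < q⁻¹ * z i := by
        rcases Nat.eq_zero_or_pos i with rfl | h0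
        · have := hpos 0 hi'
          simp only [ha, if_true]
          positivity
        · simp only [ha, h0.ne', if_false]
          have := hlt (show i - 1 < i by omega) hi'
          rw [lt_inv_mul_iff₀ hq0]
          linarith
      obtain ⟨w, h1, h2, h3⟩ := ivt i _ hab (hlow i hi) (hup i hi')
      exact ⟨w, h1, fun _ => h2, h3⟩
    · obtain ⟨b, hb, hfb⟩ := exists_pos_lt_mul_prod_sub hq hpos (a i)
      obtain ⟨w, h1, h2, h3⟩ := ivt i b hb (hlow i le_rfl) (by simpa [hf] using hfb)
      exact ⟨w, h1, fun h => absurd h (lt_irrefl _), h3⟩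
  choose! w hw1 hw2 hw3 using hroot
  refine ⟨w, fun i hi => ?_, fun i hi => ?_, fun i hi => hw3 i (by omega)⟩
  · exact (ha0 i (by omega)).trans_lt (hw1 i (by omega))
  · have h1 := hw1 (i + 1) (by omega)
    have h2 := hw2 i (by omega) (by omega)
    simp only [ha, Nat.succ_ne_zero, if_false, Nat.add_sub_cancel] at h1
    rw [lt_inv_mul_iff₀ hq0] at h2
    nlinarith

theorem multHermite_eq_prod_of_injOn {n : ℕ} {s : ℂ} {w : ℕ → ℝ}
    (hinj : Set.InjOn w (Set.Iio n)) (hw : ∀ i < n, (multHermite n s).eval (w i : ℂ) = 0) :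
    multHermite n s = ∏ i ∈ Finset.range n, (X - C (w i : ℂ)) := by
  have hle : (Finset.range n).val.map (fun i => (w i : ℂ)) ≤ (multHermite n s).roots := by
    rw [Multiset.le_iff_subset]
    · intro x hx
      obtain ⟨i, hi, rfl⟩ := Multiset.mem_map.1 hx
      exact (mem_roots (monic_multHermite n s).ne_zero).2
        (hw i (Finset.mem_range.1 hi))
    · refine Multiset.Nodup.map_on (fun i hi j hj hij => ?_) (Finset.range n).nodup
      exact hinj (Finset.mem_range.1 hi)
        (Finset.mem_range.1 hj) (Complex.ofReal_injective hij)
  have heq := Multiset.eq_of_le_of_card_le hle (by simp [card_roots_multHermite])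
  conv_lhs => rw [multHermite_eq_prod_roots, ← heq, Multiset.map_map]
  rfl

theorem exists_separated_roots_multHermite {σ : ℝ} (hσ : 0 < σ) (n : ℕ) :
    ∃ z : ℕ → ℝ, (∀ i < n, 0 < z i) ∧
      (∀ i, i + 1 < n → Real.exp (σ / 2) ^ 2 * z i < z (i + 1)) ∧
      multHermite n (σ : ℂ) = ∏ i ∈ Finset.range n, (X - C (z i : ℂ)) := by
  have hq : 1 < Real.exp (σ / 2) := Real.one_lt_exp_iff.2 (by positivity)
  induction n with
  | zero => exact ⟨fun _ => 1, by simp, by simp, by simp [multHermite_zero]⟩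
  | succ n ih =>
    obtain ⟨z, hpos, hsep, hprod⟩ := ih
    obtain ⟨w, hw1, hw2, hw3⟩ := exists_separated_zeros hq hpos hsep
    refine ⟨w, hw1, hw2, multHermite_eq_prod_of_injOn ?_ fun i hi => ?_⟩
    · have hlt : ∀ i j, i < j → j < n + 1 → w i < w j := fun i j hij hj => by
        have := mul_sq_lt_of_separated hq hw1 hw2 hij hj
        have hq2 := one_lt_pow₀ hq two_ne_zero
        nlinarith [mul_pos (sub_pos.2 hq2) (hw1 i (by omega))]
      intro i hi j hj hij
      rcases lt_trichotomy i j with h | h | h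
      · exact absurd hij (hlt i j h hj).ne
      · exact h
      · exact absurd hij (hlt j i h hi).ne'
    · have h := congrArg (fun x : ℝ => (x : ℂ)) (hw3 i hi)
      have he : Complex.exp (σ * n / 2) = Complex.exp (σ / 2) ^ n := by
        rw [← Complex.exp_nat_mul]; congr 1; ring
      rw [eval_multHermite_succ, hprod, eval_prod, eval_prod, he, Complex.exp_neg]
      simpa using h

theorem multHermite_zero_right (n : ℕ) : multHermite n 0 = (X - C 1) ^ n := by
  induction n with
  | zero => rw [multHermite_zero, pow_zero]
  | succ n ih =>
    rw [multHermite_succ, ih, pow_succ]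
    simp
    ring

theorem pos_of_mem_roots_multHermite {σ : ℝ} (hσ : 0 ≤ σ) (n : ℕ) :
    ∀ x ∈ (multHermite n (σ : ℂ)).roots, ∃ r : ℝ, 0 < r ∧ (r : ℂ) = x := by
  intro x hx
  rcases hσ.lt_or_eq with hσ | rfl
  · obtain ⟨z, hpos, -, hprod⟩ := exists_separated_roots_multHermite hσ n
    have h := isRoot_of_mem_roots hx
    rw [hprod, IsRoot, eval_prod, Finset.prod_eq_zero_iff] at h
    obtain ⟨i, hi, h⟩ := h
    refine ⟨z i, hpos i (Finset.mem_range.1 hi), ?_⟩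
    simpa [sub_eq_zero, eq_comm] using h
  · rw [Complex.ofReal_zero, multHermite_zero_right, roots_pow, roots_X_sub_C] at hx
    refine ⟨1, one_pos, ?_⟩
    have := Multiset.mem_of_mem_nsmul hx
    simpa [eq_comm] using this

theorem le_of_forall_pow_le_mul_pow {r R C : ℝ} (hR : 0 < R)
    (h : ∀ k : ℕ, k ≠ 0 → r ^ k ≤ C * R ^ k) :
    r ≤ R := by
  by_contra! hlt
  have h1 : 1 < r / R := (one_lt_div hR).2 hlt
  obtain ⟨k, hk⟩ := ((tendsto_pow_atTop_atTop_of_one_lt h1).eventually_gt_atTop C).and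
    (eventually_ne_atTop 0) |>.exists
  have h2 := h k hk.2
  have h3 := hk.1
  rw [div_pow, lt_div_iff₀ (by positivity)] at h3
  linarith

/-- All zeros being positive, `r^k` is at most the `k`-th power sum, hence at most `(n + 1) R^k` for
all `k ≥ 1`, which forces `r ≤ R`. The lower bound is the upper bound for the zero `r⁻¹`. -/
theorem bounds_of_mem_roots_multHermite {s : ℝ} (hs : 0 ≤ s) (n : ℕ) :
    ∀ x ∈ (multHermite (n + 1) ((s / (n + 1 : ℕ) : ℝ) : ℂ)).roots,
      ∃ r : ℝ, r ∈ Set.Icc (2 * Real.exp (2 * s))⁻¹ (2 * Real.exp (2 * s)) ∧ (r : ℂ) = x := by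
  set σ := s / (n + 1 : ℕ) with hσdef
  have hσ : 0 ≤ σ := by positivity
  have hnσ : (n + 1 : ℕ) * σ = s := by rw [hσdef]; field_simp
  set m := (multHermite (n + 1) (σ : ℂ)).roots with hm
  set R := 2 * Real.exp (2 * s) with hR
  have hR0 : 0 < R := by positivity
  have hpos := pos_of_mem_roots_multHermite hσ (n + 1)
  have hup : ∀ r : ℝ, 0 < r → (r : ℂ) ∈ m → r ≤ R := by
    intro r hr hrm
    refine le_of_forall_pow_le_mul_pow (C := (n + 1 : ℕ)) hR0 fun k hk => ?_
    have h1 := sum_pow_roots_multHermite (n + 1) σ hk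
    have h2 : r ^ k ≤ (n + 1 : ℕ) * PowerSeries.coeff k (psiSeries (n + 1) σ) := by
      obtain ⟨t, ht⟩ := Multiset.exists_cons_of_mem hrm
      have h3 : (m.map fun z => z ^ k).sum.re = (m.map fun z => (z ^ k).re).sum := by
        have := map_multiset_sum Complex.reAddGroupHom (m.map fun z => z ^ k)
        rw [Multiset.map_map] at this
        exact this
      have h4 := congrArg Complex.re h1
      rw [← hm, h3, Complex.ofReal_re, ht, Multiset.map_cons, Multiset.sum_cons] at h4
      rw [← h4, ← Complex.ofReal_pow, Complex.ofReal_re]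
      refine le_add_of_nonneg_right (Multiset.sum_nonneg fun y hy => ?_)
      obtain ⟨z, hz, rfl⟩ := Multiset.mem_map.1 hy
      obtain ⟨ρ, hρ, rfl⟩ := hpos z (by rw [← hm, ht]; exact Multiset.mem_cons_of_mem hz)
      rw [← Complex.ofReal_pow, Complex.ofReal_re]
      positivity
    refine h2.trans (mul_le_mul_of_nonneg_left ?_ (by positivity))
    refine (le_abs_self _).trans ((abs_coeff_psiSeries_le hσ n hnσ.le k).trans ?_)
    refine le_trans (le_of_eq ?_) (coeff_normalPsi_le hs k)
    congr 1
    rw [← Real.exp_nat_mul]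
    congr 1
    rw [← hnσ]
    push_cast
    ring
  intro x hx
  obtain ⟨r, hr, rfl⟩ := hpos x hx
  refine ⟨r, ⟨?_, hup r hr hx⟩, rfl⟩
  have hinv : ((r⁻¹ : ℝ) : ℂ) ∈ m := by
    rw [hm, ← map_inv_roots_multHermite, Complex.ofReal_inv]
    exact Multiset.mem_map_of_mem _ hx
  exact inv_le_of_inv_le₀ hr (hup _ (inv_pos.2 hr) hinv)

end Location

/-! ### Weak limits from moments on a compact set -/

section WeakLimits

open scoped ComplexConjugate

/-- The mixed moment `∫ z^a z̄^b dμ`. -/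
def mixedMoment (μ : Measure ℂ) (a b : ℕ) : ℂ := ∫ z, z ^ a * conj z ^ b ∂μ

theorem exists_probabilityMeasure_subtype {K : Set ℂ} (hK : MeasurableSet K)
    (μ : ProbabilityMeasure ℂ) (hμ : (μ : Measure ℂ) Kᶜ = 0) :
    ∃ p : ProbabilityMeasure K, (μ : Measure ℂ) = (p : Measure K).map Subtype.val := by
  have he : MeasurableEmbedding (Subtype.val : K → ℂ) := MeasurableEmbedding.subtype_coe hK
  have hmap : ((μ : Measure ℂ).comap (Subtype.val : K → ℂ)).map Subtype.val = (μ : Measure ℂ) := by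
    rw [he.map_comap, Subtype.range_coe]
    exact Measure.restrict_eq_self_of_ae_mem (mem_ae_iff.2 hμ)
  have hprob : IsProbabilityMeasure ((μ : Measure ℂ).comap (Subtype.val : K → ℂ)) := by
    constructor
    have h := congrArg (fun ν : Measure ℂ => ν Set.univ) hmap
    simp only [he.map_apply, Set.preimage_univ, measure_univ] at h
    exact h
  exact ⟨⟨_, hprob⟩, hmap.symm⟩

theorem integral_map_subtype_val {K : Set ℂ} (hK : MeasurableSet K) (p : Measure K) {E : Type*}
    [NormedAddCommGroup E] [NormedSpace ℝ E] (f : ℂ → E) :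
    ∫ z, f z ∂(p.map Subtype.val) = ∫ z, f z ∂p :=
  (MeasurableEmbedding.subtype_coe hK).integral_map f

/-- The star algebra generated by the coordinate separates points and is spanned by the monomials
`z^a z̄^b`, so Stone–Weierstrass applies. -/
theorem probabilityMeasure_subtype_ext {K : Set ℂ} (hK : IsCompact K) {p q : ProbabilityMeasure K}
    (h : ∀ a b : ℕ, ∫ z : K, (z : ℂ) ^ a * conj (z : ℂ) ^ b ∂(p : Measure K) =
      ∫ z : K, (z : ℂ) ^ a * conj (z : ℂ) ^ b ∂(q : Measure K)) : p = q := by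
  have : CompactSpace K := isCompact_iff_compactSpace.1 hK
  let x : BoundedContinuousFunction K ℂ :=
    BoundedContinuousFunction.mkOfCompact ⟨Subtype.val, continuous_subtype_val⟩
  refine ProbabilityMeasure.toMeasure_injective ?_
  refine ext_of_forall_mem_subalgebra_integral_eq_of_polish (𝕜 := ℂ)
    (A := StarAlgebra.adjoin ℂ {x}) ?_ ?_
  · intro y z hyz
    refine ⟨_, ⟨_, ⟨x, StarAlgebra.subset_adjoin ℂ _ rfl, rfl⟩, rfl⟩, ?_⟩
    exact fun hne => hyz (Subtype.ext hne)
  · intro g hg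
    have hg' : g ∈ Submodule.span ℂ
        ((Submonoid.closure ({x, star x} : Set (BoundedContinuousFunction K ℂ)) :
          Set (BoundedContinuousFunction K ℂ))) := by
      rw [← StarSubalgebra.mem_toSubalgebra, StarAlgebra.adjoin_toSubalgebra,
        ← Subalgebra.mem_toSubmodule, Algebra.adjoin_eq_span, Set.star_singleton,
        Set.singleton_union] at hg
      exact hg
    clear hg
    have hint : ∀ (r : ProbabilityMeasure K) (f : BoundedContinuousFunction K ℂ),
        Integrable (fun z => f z) (r : Measure K) := fun r f => f.integrable _
    induction hg' using Submodule.span_induction with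
    | mem f hf =>
      obtain ⟨a, b, rfl⟩ := (Submonoid.mem_closure_pair _ _ _).1 hf
      exact h a b
    | zero => simp
    | add f g _ _ hf hg =>
      simp only [BoundedContinuousFunction.add_apply]
      rw [integral_add (hint p f) (hint p g), integral_add (hint q f) (hint q g), hf, hg]
    | smul c f _ hf =>
      simp only [BoundedContinuousFunction.coe_smul]
      rw [integral_smul, integral_smul, hf]

theorem eq_of_mixedMoment_eq {K : Set ℂ} (hK : IsCompact K) {μ ν : ProbabilityMeasure ℂ}
    (hμ : (μ : Measure ℂ) Kᶜ = 0) (hν : (ν : Measure ℂ) Kᶜ = 0)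
    (h : ∀ a b, mixedMoment μ a b = mixedMoment ν a b) : μ = ν := by
  obtain ⟨p, hp⟩ := exists_probabilityMeasure_subtype hK.measurableSet μ hμ
  obtain ⟨q, hq⟩ := exists_probabilityMeasure_subtype hK.measurableSet ν hν
  have : p = q := probabilityMeasure_subtype_ext hK fun a b => by
    have := h a b
    rwa [mixedMoment, mixedMoment, hp, hq, integral_map_subtype_val hK.measurableSet,
      integral_map_subtype_val hK.measurableSet] at this
  exact ProbabilityMeasure.toMeasure_injective (by rw [hp, hq, this])

/-- Probability measures on a common compact set whose mixed moments converge have a weak limit. -/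
theorem exists_tendsto_of_tendsto_mixedMoment {K : Set ℂ} (hK : IsCompact K)
    (μ : ℕ → ProbabilityMeasure ℂ) (hμ : ∀ n, (μ n : Measure ℂ) Kᶜ = 0) (c : ℕ → ℕ → ℂ)
    (hc : ∀ a b, Tendsto (fun n => mixedMoment (μ n) a b) atTop (𝓝 (c a b))) :
    ∃ ν : ProbabilityMeasure ℂ, Tendsto μ atTop (𝓝 ν) ∧ (ν : Measure ℂ) Kᶜ = 0 ∧
      ∀ f : ℂ → ℂ, ContinuousOn f K →
        Tendsto (fun n => ∫ z, f z ∂(μ n : Measure ℂ)) atTop (𝓝 (∫ z, f z ∂(ν : Measure ℂ))) := by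
  have : CompactSpace K := isCompact_iff_compactSpace.1 hK
  have hKm := hK.measurableSet
  choose p hp using fun n => exists_probabilityMeasure_subtype hKm (μ n) (hμ n)
  have hlim : ∀ (U : Ultrafilter ℕ) (y : ProbabilityMeasure K), Tendsto p U (𝓝 y) →
      ∀ f : K → ℂ, Continuous f → Tendsto (fun n => ∫ z, f z ∂(p n : Measure K)) U
        (𝓝 (∫ z, f z ∂(y : Measure K))) := fun U y hy f hf =>
    (ProbabilityMeasure.tendsto_iff_forall_integral_rclike_tendsto ℂ).1 hy
      (BoundedContinuousFunction.mkOfCompact ⟨f, hf⟩)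
  -- Every cluster point has mixed moments `c`, so there is only one; as the space of probability
  -- measures on `K` is compact, the sequence converges.
  have hcl : ∀ y, MapClusterPt y atTop p → ∀ a b : ℕ,
      ∫ z : K, (z : ℂ) ^ a * conj (z : ℂ) ^ b ∂(y : Measure K) = c a b := by
    intro y hy a b
    obtain ⟨U, hU, hyU⟩ := mapClusterPt_iff_ultrafilter.1 hy
    refine tendsto_nhds_unique (hlim U y hyU _ (by fun_prop))
      (((hc a b).mono_left hU).congr fun n => ?_)
    rw [mixedMoment, hp, integral_map_subtype_val hKm]
  obtain ⟨y, hy⟩ : ∃ y, MapClusterPt y atTop p := exists_clusterPt_of_compactSpace _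
  have hty : Tendsto p atTop (𝓝 y) := tendsto_nhds_of_unique_mapClusterPt fun x hx =>
    probabilityMeasure_subtype_ext hK fun a b => by rw [hcl x hx, hcl y hy]
  have hcont : Continuous (Subtype.val : K → ℂ) := continuous_subtype_val
  refine ⟨y.map hcont.aemeasurable, ?_, ?_, fun f hf => ?_⟩
  · have h := ProbabilityMeasure.tendsto_map_of_tendsto_of_continuous p y hty hcont
    refine h.congr fun n => ?_
    refine ProbabilityMeasure.toMeasure_injective ?_
    rw [ProbabilityMeasure.toMeasure_map, hp]
  · rw [ProbabilityMeasure.toMeasure_map, Measure.map_apply hcont.measurable hKm.compl]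
    have : (Subtype.val : K → ℂ) ⁻¹' Kᶜ = ∅ := by ext z; simp
    rw [this, measure_empty]
  -- Convergence on `K` itself allows test functions that are unbounded or discontinuous off `K`,
  -- such as `z^k` and functions of `z⁻¹`.
  · have h := (ProbabilityMeasure.tendsto_iff_forall_integral_rclike_tendsto ℂ).1 hty
      (BoundedContinuousFunction.mkOfCompact ⟨fun z : K => f z, hf.domRestrict⟩)
    rw [ProbabilityMeasure.toMeasure_map, integral_map_subtype_val hKm]
    refine h.congr fun n => ?_
    rw [hp, integral_map_subtype_val hKm]
    rfl

/-! On the real line and on the unit circle the mixed moments are determined by the moments. -/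

theorem mixedMoment_of_real {μ : Measure ℂ} (h : ∀ᵐ z ∂μ, conj z = z) (a b : ℕ) :
    mixedMoment μ a b = moment μ (a + b) := by
  refine integral_congr_ae ?_
  filter_upwards [h] with z hz
  rw [hz, pow_add]

theorem mixedMoment_of_circle {μ : Measure ℂ} (h : ∀ᵐ z ∂μ, ‖z‖ = 1) (a b : ℕ) :
    mixedMoment μ a b = if b ≤ a then moment μ (a - b) else conj (moment μ (b - a)) := by
  have hz' : ∀ z : ℂ, ‖z‖ = 1 → z * conj z = 1 := fun z hz => by
    rw [Complex.mul_conj, Complex.normSq_eq_norm_sq, hz]; simp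
  split_ifs with hab
  · refine integral_congr_ae ?_
    filter_upwards [h] with z hz
    obtain ⟨d, rfl⟩ := Nat.exists_eq_add_of_le hab
    rw [Nat.add_sub_cancel_left, pow_add, mul_right_comm, ← mul_pow, hz' z hz, one_pow, one_mul]
  · rw [moment, ← integral_conj]
    refine integral_congr_ae ?_
    filter_upwards [h] with z hz
    obtain ⟨d, rfl⟩ := Nat.exists_eq_add_of_le (Nat.le_of_not_le hab)
    rw [Nat.add_sub_cancel_left, pow_add, ← mul_assoc, ← mul_pow, hz' z hz, one_pow, one_mul,
      map_pow]

theorem moment_zero (μ : Measure ℂ) [IsProbabilityMeasure μ] : moment μ 0 = 1 := by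
  simp [moment]

/-- A compact set on which the analytic moments determine the mixed moments. -/
def RealOrCircle (K : Set ℂ) : Prop := (∀ z ∈ K, conj z = z) ∨ ∀ z ∈ K, ‖z‖ = 1

theorem ae_mem_of_compl {μ : Measure ℂ} {K : Set ℂ} (h : μ Kᶜ = 0) : ∀ᵐ z ∂μ, z ∈ K :=
  mem_ae_iff.2 h

theorem eq_of_moment_eq {K : Set ℂ} (hK : IsCompact K) (hKr : RealOrCircle K)
    {μ ν : ProbabilityMeasure ℂ} (hμ : (μ : Measure ℂ) Kᶜ = 0) (hν : (ν : Measure ℂ) Kᶜ = 0)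
    (h : ∀ k, 1 ≤ k → moment μ k = moment ν k) : μ = ν := by
  have h' : ∀ k, moment μ k = moment ν k := fun k => by
    rcases Nat.eq_zero_or_pos k with rfl | hk
    · rw [moment_zero, moment_zero]
    · exact h k hk
  refine eq_of_mixedMoment_eq hK hμ hν fun a b => ?_
  rcases hKr with hr | hr
  · rw [mixedMoment_of_real ((ae_mem_of_compl hμ).mono hr),
      mixedMoment_of_real ((ae_mem_of_compl hν).mono hr), h']
  · rw [mixedMoment_of_circle ((ae_mem_of_compl hμ).mono hr),
      mixedMoment_of_circle ((ae_mem_of_compl hν).mono hr), h', h']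

theorem exists_tendsto_of_tendsto_moment {K : Set ℂ} (hK : IsCompact K) (hKr : RealOrCircle K)
    (μ : ℕ → ProbabilityMeasure ℂ) (hμ : ∀ n, (μ n : Measure ℂ) Kᶜ = 0) (c : ℕ → ℂ)
    (hc : ∀ k, 1 ≤ k → Tendsto (fun n => moment (μ n) k) atTop (𝓝 (c k))) :
    ∃ ν : ProbabilityMeasure ℂ, Tendsto μ atTop (𝓝 ν) ∧ (ν : Measure ℂ) Kᶜ = 0 ∧
      ∀ f : ℂ → ℂ, ContinuousOn f K →
        Tendsto (fun n => ∫ z, f z ∂(μ n : Measure ℂ)) atTop (𝓝 (∫ z, f z ∂(ν : Measure ℂ))) := by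
  have hc' : ∀ k, ∃ l, Tendsto (fun n => moment (μ n) k) atTop (𝓝 l) := fun k => by
    rcases Nat.eq_zero_or_pos k with rfl | hk
    · exact ⟨1, by simp only [moment_zero, tendsto_const_nhds]⟩
    · exact ⟨_, hc k hk⟩
  choose c' hc' using hc'
  rcases hKr with hr | hr
  · refine exists_tendsto_of_tendsto_mixedMoment hK μ hμ (fun a b => c' (a + b)) fun a b => ?_
    simp only [fun n => mixedMoment_of_real ((ae_mem_of_compl (hμ n)).mono hr) a b]
    exact hc' _
  · refine exists_tendsto_of_tendsto_mixedMoment hK μ hμ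
      (fun a b => if b ≤ a then c' (a - b) else conj (c' (b - a))) fun a b => ?_
    simp only [fun n => mixedMoment_of_circle ((ae_mem_of_compl (hμ n)).mono hr) a b]
    split_ifs
    · exact hc' _
    · exact (Complex.continuous_conj.tendsto _).comp (hc' _)

/-! Integrals against zero distributions. -/

theorem integrable_and_integral_sum_dirac (m : Multiset ℂ) (f : ℂ → ℂ) :
    Integrable f (m.map fun z => Measure.dirac z).sum ∧
      ∫ z, f z ∂(m.map fun z => Measure.dirac z).sum = (m.map f).sum := by
  induction m using Multiset.induction_on with
  | empty => simp
  | cons a m ih =>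
    have ha : Integrable f (Measure.dirac a) := integrable_dirac enorm_lt_top
    rw [Multiset.map_cons, Multiset.sum_cons, Multiset.map_cons, Multiset.sum_cons]
    refine ⟨ha.add_measure ih.1, ?_⟩
    rw [integral_add_measure ha ih.1, integral_dirac, ih.2]

theorem integral_zeroMeasure (P : Polynomial ℂ) (f : ℂ → ℂ) :
    ∫ z, f z ∂(zeroMeasure P) = (P.natDegree : ℂ)⁻¹ * (P.roots.map f).sum := by
  rw [zeroMeasure, integral_smul_measure, (integrable_and_integral_sum_dirac _ f).2]
  simp

theorem zeroMeasure_compl_eq_zero {P : Polynomial ℂ} {K : Set ℂ} (hK : MeasurableSet K)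
    (h : ∀ z ∈ P.roots, z ∈ K) : zeroMeasure P Kᶜ = 0 := by
  rw [zeroMeasure, Measure.smul_apply]
  suffices hm : ∀ m : Multiset ℂ, (∀ z ∈ m, z ∈ K) →
      (m.map fun z => Measure.dirac z).sum Kᶜ = 0 by
    rw [hm _ h, smul_zero]
  intro m
  induction m using Multiset.induction_on with
  | empty => simp
  | cons a m ih =>
    intro hm
    rw [Multiset.map_cons, Multiset.sum_cons, Measure.add_apply,
      ih fun z hz => hm z (Multiset.mem_cons_of_mem hz), Measure.dirac_apply' _ hK.compl]
    simp [hm a (Multiset.mem_cons_self a m)]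

theorem integral_hermiteZeroDistribution (s : ℝ) (n : ℕ) (f : ℂ → ℂ) :
    ∫ z, f z ∂(hermiteZeroDistribution s (n + 1) n.succ_ne_zero : Measure ℂ) =
      ((n + 1 : ℕ) : ℂ)⁻¹ *
        ((multHermite (n + 1) ((s / (n + 1 : ℕ) : ℝ) : ℂ)).roots.map f).sum := by
  have : (((s / (n + 1 : ℕ) : ℝ)) : ℂ) = (s : ℂ) / ((n + 1 : ℕ) : ℂ) := by push_cast; rfl
  rw [this]
  have h := integral_zeroMeasure (multHermite (n + 1) ((s : ℂ) / ((n + 1 : ℕ) : ℂ))) f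
  rw [natDegree_multHermite] at h
  exact h

theorem moment_hermiteZeroDistribution (s : ℝ) (n : ℕ) {k : ℕ} (hk : 1 ≤ k) :
    moment (hermiteZeroDistribution s (n + 1) n.succ_ne_zero : Measure ℂ) k =
      ((PowerSeries.coeff k (psiSeries (n + 1) (s / (n + 1 : ℕ))) : ℝ) : ℂ) := by
  rw [moment, integral_hermiteZeroDistribution, sum_pow_roots_multHermite _ _ (by omega)]
  have : ((n + 1 : ℕ) : ℂ) ≠ 0 := by exact_mod_cast n.succ_ne_zero
  rw [Complex.ofReal_mul, Complex.ofReal_natCast, inv_mul_cancel_left₀ this]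

theorem tendsto_moment_hermiteZeroDistribution (s : ℝ) {k : ℕ} (hk : 1 ≤ k) :
    Tendsto (fun n : ℕ => moment (hermiteZeroDistribution s (n + 1) n.succ_ne_zero : Measure ℂ) k)
      atTop (𝓝 ((PowerSeries.coeff k (normalPsi s) : ℝ) : ℂ)) := by
  simp only [moment_hermiteZeroDistribution s _ hk]
  refine (Complex.continuous_ofReal.tendsto _).comp
    (tendsto_coeff_psiSeries_and_ratioSeries s k (fun n => s / (n + 1 : ℕ)) ?_).1
  -- The parameter is `s / (n + 1)` at index `n`, so `n σ n = s n / (n + 1)` tends to `s` without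
  -- being equal to it.
  have h := (tendsto_natCast_div_add_atTop (1 : ℝ)).const_mul s
  rw [mul_one] at h
  refine h.congr fun n => ?_
  push_cast
  ring

theorem integral_inv_hermiteZeroDistribution (s : ℝ) (n : ℕ) (f : ℂ → ℂ) :
    ∫ z, f z⁻¹ ∂(hermiteZeroDistribution s (n + 1) n.succ_ne_zero : Measure ℂ) =
      ∫ z, f z ∂(hermiteZeroDistribution s (n + 1) n.succ_ne_zero : Measure ℂ) := by
  rw [integral_hermiteZeroDistribution, integral_hermiteZeroDistribution]
  conv_rhs => rw [← map_inv_roots_multHermite, Multiset.map_map]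
  rfl

end WeakLimits

/-! ### From formal series to the analytic S-transform -/

section STransform

open PowerSeries

/-- The Taylor series at `0`. -/
def taylorSeries (f : ℂ → ℂ) : ℂ⟦X⟧ := PowerSeries.mk fun k => iteratedDeriv k f 0 / k.factorial

theorem taylorSeries_mul {f g : ℂ → ℂ} (hf : AnalyticAt ℂ f 0) (hg : AnalyticAt ℂ g 0) :
    taylorSeries (fun t => f t * g t) = taylorSeries f * taylorSeries g := by
  ext n
  rw [coeff_mul, Finset.Nat.sum_antidiagonal_eq_sum_range_succ_mk, taylorSeries, coeff_mk,
    iteratedDeriv_fun_mul hf.contDiffAt hg.contDiffAt, Finset.sum_div]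
  refine Finset.sum_congr rfl fun i hi => ?_
  have hi' : i ≤ n := Nat.lt_succ_iff.1 (Finset.mem_range.1 hi)
  simp only [taylorSeries, coeff_mk]
  have h := Nat.choose_mul_factorial_mul_factorial hi'
  have h' : (n.choose i : ℂ) * i.factorial * (n - i).factorial = n.factorial := by exact_mod_cast h
  rw [← h']
  have h1 : (i.factorial : ℂ) ≠ 0 := by exact_mod_cast i.factorial_ne_zero
  have h2 : ((n - i).factorial : ℂ) ≠ 0 := by exact_mod_cast (n - i).factorial_ne_zero
  have h3 : (n.choose i : ℂ) ≠ 0 := by exact_mod_cast (Nat.choose_pos hi').ne'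
  field_simp

theorem taylorSeries_one_add (f : ℂ → ℂ) :
    taylorSeries (fun t => 1 + f t) = 1 + taylorSeries f := by
  ext n
  cases n with
  | zero => simp [taylorSeries]
  | succ n => simp [taylorSeries, iteratedDeriv_const_add n.succ_pos, coeff_one]

theorem taylorSeries_const_mul {f : ℂ → ℂ} (hf : AnalyticAt ℂ f 0) (c : ℂ) :
    taylorSeries (fun t => c * f t) = C c * taylorSeries f := by
  ext n
  rw [coeff_C_mul]
  simp only [taylorSeries, coeff_mk]
  rw [iteratedDeriv_const_mul c hf.contDiffAt, mul_div_assoc]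

theorem taylorSeries_id : taylorSeries (fun t => t) = X := by
  ext n
  simp only [taylorSeries, coeff_mk, iteratedDeriv_fun_id_zero, coeff_X]
  split_ifs with h
  · simp [h]
  · simp

theorem derivative_taylorSeries (f : ℂ → ℂ) :
    d⁄dX ℂ (taylorSeries f) = taylorSeries (deriv f) := by
  ext n
  rw [coeff_derivative]
  simp only [taylorSeries, coeff_mk]
  rw [iteratedDeriv_succ', Nat.factorial_succ]
  have h1 : ((n : ℂ) + 1) ≠ 0 := by exact_mod_cast n.succ_ne_zero
  push_cast
  field_simp

theorem eventuallyEq_of_taylorSeries_eq {f g : ℂ → ℂ} (hf : AnalyticAt ℂ f 0)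
    (hg : AnalyticAt ℂ g 0) (h : taylorSeries f = taylorSeries g) : f =ᶠ[𝓝 0] g := by
  have h1 := hf.hasFPowerSeriesAt
  have h2 := hg.hasFPowerSeriesAt
  have h3 : (fun n => iteratedDeriv n f 0 / (n.factorial : ℂ)) =
      fun n => iteratedDeriv n g 0 / (n.factorial : ℂ) := by
    ext n
    simpa [taylorSeries] using congrArg (coeff n) h
  rw [h3] at h1
  have h4 := h1.eventually_hasSum_sub
  have h5 := h2.eventually_hasSum_sub
  filter_upwards [h4, h5] with t ht1 ht2
  exact ht1.unique ht2

/-- A power series with geometrically bounded coefficients defines an analytic function with that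
Taylor series. -/
theorem exists_analyticAt_of_norm_coeff_le {c : ℂ⟦X⟧} {R : ℝ} (hR : 0 < R)
    (hc : ∀ k, ‖coeff k c‖ ≤ R ^ k) :
    AnalyticAt ℂ (fun t => ∑' k, coeff k c * t ^ k) 0 ∧
      taylorSeries (fun t => ∑' k, coeff k c * t ^ k) = c := by
  set p := FormalMultilinearSeries.ofScalars ℂ (fun k => coeff k c) with hp
  have hr : 0 < p.radius := by
    have : ((R⁻¹).toNNReal : ENNReal) ≤ p.radius := by
      refine p.le_radius_of_bound 1 fun n => ?_
      rw [FormalMultilinearSeries.ofScalars_norm, Real.coe_toNNReal _ (by positivity), inv_pow,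
        ← div_eq_mul_inv, div_le_one (by positivity)]
      exact hc n
    refine lt_of_lt_of_le ?_ this
    simpa using hR
  have h1 := (p.hasFPowerSeriesOnBall hr).hasFPowerSeriesAt
  have h2 : p.sum = fun t => ∑' k, coeff k c * t ^ k := by
    ext t
    have := FormalMultilinearSeries.ofScalars_sum_eq (fun k => coeff k c) t
    simpa [FormalMultilinearSeries.ofScalarsSum] using this
  rw [h2] at h1
  refine ⟨h1.analyticAt, ?_⟩
  have h3 := h1.eq_formalMultilinearSeries h1.analyticAt.hasFPowerSeriesAt
  have h4 := FormalMultilinearSeries.ofScalars_series_injective ℂ ℂ h3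
  ext n
  rw [taylorSeries, coeff_mk]
  exact (congrFun h4 n).symm

/-- The functional equation of the `ψ`-transform of the free multiplicative normal law. -/
theorem eventually_eq_mul_exp_mul {s : ℝ} {f : ℂ → ℂ} (hf : AnalyticAt ℂ f 0)
    (hT : taylorSeries f = PowerSeries.map Complex.ofRealHom (normalPsi s)) :
    ∀ᶠ t in 𝓝 0, f t = t * (Complex.exp (s / 2 + s * f t) * (1 + f t)) := by
  set g : ℂ → ℂ := fun t => Complex.exp (s / 2 + s * f t) with hg
  have hga : AnalyticAt ℂ g 0 := (analyticAt_const.add (analyticAt_const.mul hf)).cexp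
  have ha1 : AnalyticAt ℂ (fun t => s * deriv f t) 0 := analyticAt_const.mul hf.deriv
  have ha2 : AnalyticAt ℂ (fun t => 1 + f t) 0 := analyticAt_const.add hf
  have hf0 : f 0 = 0 := by
    have h := congrArg (coeff 0) hT
    rw [coeff_map, coeff_zero_normalPsi, map_zero] at h
    simpa [taylorSeries] using h
  have hder : deriv g =ᶠ[𝓝 0] fun t => (s * deriv f t) * g t := by
    filter_upwards [hf.eventually_analyticAt] with t ht
    have h1 := ((ht.differentiableAt.hasDerivAt.const_mul (s : ℂ)).const_add ((s : ℂ) / 2)).cexp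
    rw [h1.deriv, mul_comm]
  have hmapder : ∀ F : ℝ⟦X⟧, d⁄dX ℂ (PowerSeries.map Complex.ofRealHom F) =
      PowerSeries.map Complex.ofRealHom (d⁄dX ℝ F) := fun F => by
    ext n
    simp [coeff_derivative]
  -- Both series solve `G' = s Ψ' G` with `G(0) = e^{s/2}`.
  have hTg : taylorSeries g = PowerSeries.map Complex.ofRealHom (normalExp s) := by
    refine eq_of_derivative_eq_mul (A := C (s : ℂ) * taylorSeries (deriv f)) ?_ ?_ ?_
    · have h1 : taylorSeries (deriv g) = taylorSeries (fun t => (s * deriv f t) * g t) := by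
        ext n
        simp only [taylorSeries, coeff_mk, hder.iteratedDeriv_eq]
      rw [derivative_taylorSeries, h1, taylorSeries_mul ha1 hga,
        taylorSeries_const_mul hf.deriv]
    · rw [hmapder, derivative_normalExp, map_mul, map_mul, ← derivative_taylorSeries, hT, hmapder,
        map_C]
      rfl
    · rw [coeff_map, coeff_zero_normalExp]
      simp [taylorSeries, hg, hf0]
  refine eventuallyEq_of_taylorSeries_eq hf
    (analyticAt_id.mul (hga.mul ha2)) ?_
  have h1 := taylorSeries_mul (f := fun t => t) (g := fun t => g t * (1 + f t)) analyticAt_id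
    (hga.mul ha2)
  rw [taylorSeries_id, taylorSeries_mul hga ha2, taylorSeries_one_add f, hTg,
    hT] at h1
  refine Eq.trans ?_ h1.symm
  rw [hT]
  conv_lhs => rw [normalPsi_eq]
  simp

theorem norm_moment_le {μ : Measure ℂ} [IsProbabilityMeasure μ] {R : ℝ}
    (h : ∀ᵐ z ∂μ, ‖z‖ ≤ R) (k : ℕ) : ‖moment μ k‖ ≤ R ^ k := by
  have := norm_integral_le_of_norm_le_const (μ := μ) (f := fun z : ℂ => z ^ k) (C := R ^ k) (by
    filter_upwards [h] with z hz
    rw [norm_pow]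
    gcongr)
  simpa [moment] using this

theorem hasSTransform_of_moment_eq {s : ℝ} {μ : Measure ℂ} [IsProbabilityMeasure μ] {K : Set ℂ}
    (hK : IsCompact K) (hμ : μ Kᶜ = 0)
    (hm : ∀ k, 1 ≤ k → moment μ k = ((coeff k (normalPsi s) : ℝ) : ℂ)) :
    HasSTransform μ fun z => Complex.exp (-(s : ℂ) * (z + 1 / 2)) := by
  obtain ⟨R, hR0, hR⟩ := hK.isBounded.exists_pos_norm_le
  have hbd := norm_moment_le ((ae_mem_of_compl hμ).mono hR)
  set c := PowerSeries.map Complex.ofRealHom (normalPsi s) with hc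
  have hcm : ∀ k, coeff k c = if k = 0 then 0 else moment μ k := fun k => by
    rw [hc, coeff_map]
    split_ifs with hk
    · rw [hk, coeff_zero_normalPsi, map_zero]
    · exact (hm k (by omega)).symm
  have hcb : ∀ k, ‖coeff k c‖ ≤ R ^ k := fun k => by
    rw [hcm]
    split_ifs
    · rw [norm_zero]; positivity
    · exact hbd k
  obtain ⟨hfa, hT⟩ := exists_analyticAt_of_norm_coeff_le hR0 hcb
  set f : ℂ → ℂ := fun t => ∑' k, coeff k c * t ^ k with hf
  have hψ : ∀ t : ℂ, psiTransform μ t = f t := fun t => by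
    have h0 : coeff 0 c * t ^ 0 = 0 := by rw [hcm]; simp
    have hsupp : Function.support (fun k => coeff k c * t ^ k) ⊆ Set.range Nat.succ := by
      intro k hk
      rcases k with _ | k
      · exact absurd h0 hk
      · exact ⟨k, rfl⟩
    change psiTransform μ t = ∑' k, coeff k c * t ^ k
    rw [← Nat.succ_injective.tsum_eq hsupp, psiTransform]
    refine tsum_congr fun k => ?_
    rw [hcm, if_neg k.succ_ne_zero]
  refine ⟨by fun_prop, ?_⟩
  have hne : ∀ᶠ t in 𝓝[≠] (0 : ℂ), t ≠ 0 := eventually_mem_nhdsWithin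
  filter_upwards [(eventually_eq_mul_exp_mul hfa hT).filter_mono nhdsWithin_le_nhds, hne]
    with t ht ht0
  rw [hψ]
  have hne : f t ≠ 0 := fun h0 => by
    rw [h0] at ht
    simp [ht0, Complex.exp_ne_zero] at ht
  refine ⟨hne, ?_⟩
  -- The candidate `S`, evaluated at `ψ`, is the reciprocal of the exponential in the functional
  -- equation.
  have hexp : Complex.exp (-(s : ℂ) * (f t + 1 / 2)) * Complex.exp (s / 2 + s * f t) = 1 := by
    rw [← Complex.exp_add, show -(s : ℂ) * (f t + 1 / 2) + (s / 2 + s * f t) = 0 by ring,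
      Complex.exp_zero]
  rw [div_mul_eq_mul_div, eq_div_iff hne]
  linear_combination Complex.exp (-(s : ℂ) * (f t + 1 / 2)) * ht + t * (1 + f t) * hexp

end STransform

/-! ### Common support, uniqueness and symmetry of the limit law -/

section LimitLaw

/-- A compact set that contains the zeros of all `H_n^*(·; s/n)`: a compact interval in `(0, ∞)`
if `s ≥ 0`, intersected with the unit circle if `s ≤ 0`. -/
def zeroRegion (s : ℝ) : Set ℂ :=
  {z | (0 ≤ s → z ∈ (fun x : ℝ => (x : ℂ)) ''
      Set.Icc (2 * Real.exp (2 * s))⁻¹ (2 * Real.exp (2 * s))) ∧ (s ≤ 0 → ‖z‖ = 1)}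

theorem isCompact_ofReal_image {K : Set ℝ} (hK : IsCompact K) :
    IsCompact ((fun x : ℝ => (x : ℂ)) '' K) :=
  hK.image Complex.continuous_ofReal

theorem isCompact_zeroRegion (s : ℝ) : IsCompact (zeroRegion s) := by
  have h1 : IsCompact ((fun x : ℝ => (x : ℂ)) ''
      Set.Icc (2 * Real.exp (2 * s))⁻¹ (2 * Real.exp (2 * s))) :=
    isCompact_ofReal_image isCompact_Icc
  have h2 : IsCompact {z : ℂ | ‖z‖ = 1} := by
    convert! isCompact_sphere (0 : ℂ) 1 using 1
    ext z; simp
  rcases lt_trichotomy s 0 with h | h | h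
  · simpa [zeroRegion, h.le, h.not_ge] using h2
  · have := h1.inter h2
    subst h
    simpa only [zeroRegion, le_refl, forall_const, Set.mem_inter_iff, Set.ofPred_and,
      Set.ofPred_mem_eq] using this
  · simpa only [zeroRegion, h.le, h.not_ge, forall_const, IsEmpty.forall_iff, and_true,
      Set.ofPred_mem_eq] using h1

theorem mem_zeroRegion_of_mem_roots (s : ℝ) (n : ℕ) {z : ℂ}
    (hz : z ∈ (multHermite (n + 1) ((s / (n + 1 : ℕ) : ℝ) : ℂ)).roots) : z ∈ zeroRegion s := by
  refine ⟨fun hs => ?_, fun hs => ?_⟩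
  · exact bounds_of_mem_roots_multHermite hs n z hz
  · exact norm_eq_one_of_mem_roots_multHermite
      (div_nonpos_of_nonpos_of_nonneg hs (by positivity)) (n + 1) z hz

theorem hermiteZeroDistribution_compl_zeroRegion (s : ℝ) (n : ℕ) :
    (hermiteZeroDistribution s (n + 1) n.succ_ne_zero : Measure ℂ) (zeroRegion s)ᶜ = 0 := by
  refine zeroMeasure_compl_eq_zero (isCompact_zeroRegion s).measurableSet fun z hz => ?_
  refine mem_zeroRegion_of_mem_roots s n ?_
  rwa [Complex.ofReal_div, Complex.ofReal_natCast]

theorem realOrCircle_zeroRegion (s : ℝ) : RealOrCircle (zeroRegion s) := by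
  rcases le_total 0 s with h | h
  · left
    rintro z ⟨hz, -⟩
    obtain ⟨x, -, rfl⟩ := hz h
    exact Complex.conj_ofReal x
  · exact Or.inr fun z hz => hz.2 h

theorem ne_zero_of_mem_zeroRegion {s : ℝ} {z : ℂ} (hz : z ∈ zeroRegion s) : z ≠ 0 := by
  rcases le_total 0 s with h | h
  · obtain ⟨x, hx, rfl⟩ := hz.1 h
    have : 0 < x := lt_of_lt_of_le (by positivity) hx.1
    exact Complex.ofReal_ne_zero.2 this.ne'
  · intro h0
    have := hz.2 h
    simp [h0] at this

theorem supportedOnCompactPositive_of_zeroRegion {s : ℝ} (hs : 0 ≤ s) {μ : Measure ℂ}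
    (hμ : μ (zeroRegion s)ᶜ = 0) : SupportedOnCompactPositive μ := by
  refine ⟨Set.Icc (2 * Real.exp (2 * s))⁻¹ (2 * Real.exp (2 * s)), isCompact_Icc, ?_, ?_⟩
  · exact fun x hx => lt_of_lt_of_le (by positivity) hx.1
  · exact measure_mono_null (Set.compl_subset_compl.2 fun z hz => hz.1 hs) hμ

theorem supportedOnUnitCircle_of_zeroRegion {s : ℝ} (hs : s ≤ 0) {μ : Measure ℂ}
    (hμ : μ (zeroRegion s)ᶜ = 0) : SupportedOnUnitCircle μ :=
  measure_mono_null (Set.compl_subset_compl.2 fun z hz => by simpa using hz.2 hs) hμ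

/-- Uniqueness of the law with the given support and moments. -/
theorem eq_of_zeroRegion_of_moment_eq {s : ℝ} {μ ν : ProbabilityMeasure ℂ}
    (hμ : (μ : Measure ℂ) (zeroRegion s)ᶜ = 0)
    (hpos : 0 ≤ s → SupportedOnCompactPositive (ν : Measure ℂ))
    (huni : s ≤ 0 → SupportedOnUnitCircle (ν : Measure ℂ))
    (h : ∀ k, 1 ≤ k → moment ν k = moment μ k) : ν = μ := by
  -- The compact support of `ν` need not lie in `zeroRegion s`, so both measures are compared on the
  -- union.
  have key : ∀ K : Set ℂ, IsCompact K → RealOrCircle (K ∪ zeroRegion s) →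
      (ν : Measure ℂ) Kᶜ = 0 → ν = μ := fun K hK hKr hν =>
    eq_of_moment_eq (hK.union (isCompact_zeroRegion s)) hKr
      (measure_mono_null (Set.compl_subset_compl.2 Set.subset_union_left) hν)
      (measure_mono_null (Set.compl_subset_compl.2 Set.subset_union_right) hμ) h
  rcases le_total 0 s with hs | hs
  · obtain ⟨K, hK, -, hν⟩ := hpos hs
    refine key _ (isCompact_ofReal_image hK) (Or.inl ?_) hν
    rintro z (⟨x, -, rfl⟩ | hz)
    · exact Complex.conj_ofReal x
    · obtain ⟨x, -, rfl⟩ := hz.1 hs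
      exact Complex.conj_ofReal x
  · refine key _ (isCompact_sphere 0 1) (Or.inr ?_) (huni hs)
    rintro z (hz | hz)
    · simpa using hz
    · exact hz.2 hs

/-- For each `n` the integrals of `f` and of `f(1/z)` agree. Since `zeroRegion s` avoids `0`, both
integrands are continuous there and the equality passes to the limit. -/
theorem map_inv_eq_of_tendsto_integral {s : ℝ} {μ : ProbabilityMeasure ℂ}
    (h : ∀ f : ℂ → ℂ, ContinuousOn f (zeroRegion s) → Tendsto (fun n : ℕ =>
      ∫ z, f z ∂(hermiteZeroDistribution s (n + 1) n.succ_ne_zero : Measure ℂ)) atTop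
        (𝓝 (∫ z, f z ∂(μ : Measure ℂ)))) :
    (μ : Measure ℂ).map (fun z : ℂ => z⁻¹) = (μ : Measure ℂ) := by
  have hprob : IsProbabilityMeasure ((μ : Measure ℂ).map (fun z : ℂ => z⁻¹)) :=
    Measure.isProbabilityMeasure_map measurable_inv.aemeasurable
  refine ext_of_forall_integral_eq_of_IsFiniteMeasure fun f => ?_
  rw [integral_map measurable_inv.aemeasurable f.continuous.aestronglyMeasurable]
  have hf : Continuous fun z : ℂ => (f z : ℂ) := Complex.continuous_ofReal.comp f.continuous
  have h1 := h (fun z => (f z : ℂ)) hf.continuousOn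
  have h2 := h (fun z => (f z⁻¹ : ℂ)) (hf.comp_continuousOn
    (continuousOn_inv₀.mono fun z hz => ne_zero_of_mem_zeroRegion hz))
  have h3 := tendsto_nhds_unique h2 (h1.congr fun n =>
    (integral_inv_hermiteZeroDistribution s n fun z => (f z : ℂ)).symm)
  rw [integral_complex_ofReal, integral_complex_ofReal] at h3
  exact Complex.ofReal_injective h3

theorem limitLawProperties_of_moment_eq {s : ℝ} {μ : Measure ℂ} (hμ : μ (zeroRegion s)ᶜ = 0)
    (hinv : μ.map (fun z : ℂ => z⁻¹) = μ)
    (hm : ∀ k, 1 ≤ k → moment μ k = ((PowerSeries.coeff k (normalPsi s) : ℝ) : ℂ)) :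
    LimitLawProperties s μ where
  positive hs := supportedOnCompactPositive_of_zeroRegion hs hμ
  unitary hs := supportedOnUnitCircle_of_zeroRegion hs hμ
  map_inv := hinv
  moment_coeff k hk := by rw [hm k hk, coeff_normalPsi s hk]
  moment_sum k hk := by rw [hm k hk, coeff_normalPsi s hk, coeff_momentSeries s hk]
  moment_laguerre k hk := by
    rw [hm k hk, coeff_normalPsi s hk, coeff_momentSeries s hk, sum_choose_eq_laguerre s hk]

end LimitLaw

end MultHermite

end

/-! ### The main theorem -/

theorem mainTheorem1 (s : ℝ) :
    ∃ μ : ProbabilityMeasure ℂ,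
      Tendsto (fun n : ℕ => MultHermite.hermiteZeroDistribution s (n + 1) n.succ_ne_zero)
        atTop (𝓝 μ) ∧
      MultHermite.IsFreeMultiplicativeNormal s (μ : Measure ℂ) ∧
      MultHermite.LimitLawProperties s (μ : Measure ℂ) ∧
      ∀ ν : ProbabilityMeasure ℂ,
        MultHermite.LimitLawProperties s (ν : Measure ℂ) → ν = μ := by
  obtain ⟨μ, hlim, hμ, hint⟩ := MultHermite.exists_tendsto_of_tendsto_moment
    (MultHermite.isCompact_zeroRegion s)
    (MultHermite.realOrCircle_zeroRegion s) _
    (MultHermite.hermiteZeroDistribution_compl_zeroRegion s) _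
    fun k hk => MultHermite.tendsto_moment_hermiteZeroDistribution s hk
  have hm : ∀ k, 1 ≤ k →
      MultHermite.moment μ k = ((PowerSeries.coeff k (MultHermite.normalPsi s) : ℝ) : ℂ) :=
    fun k hk => tendsto_nhds_unique (hint (fun z => z ^ k) (by fun_prop))
      (MultHermite.tendsto_moment_hermiteZeroDistribution s hk)
  have hprop := MultHermite.limitLawProperties_of_moment_eq hμ
    (MultHermite.map_inv_eq_of_tendsto_integral hint) hm
  refine ⟨μ, hlim, ⟨hprop.positive, hprop.unitary,
    MultHermite.hasSTransform_of_moment_eq (MultHermite.isCompact_zeroRegion s) hμ hm⟩,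
    hprop, fun ν hν => ?_⟩
  exact MultHermite.eq_of_zeroRegion_of_moment_eq hμ hν.positive hν.unitary fun k hk => by
    rw [hν.moment_coeff k hk, hprop.moment_coeff k hk]
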